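/- **Setting.** All Hilbert spaces are real. For $i=1,2$ let $(X^i,\mathcal X^i,\mu^i)$ be a $\sigma$-finite measure space that is standard (some conegligible measurable subset is a standard Borel space), and let $(Z,\mathcal Z,\nu)$ be a $\sigma$-finite measure space with countably generated $\sigma$-algebra. "$\nu$-measurable" means measurable for the $\nu$-completion of $\mathcal Z$, and similarly for $\mu^i$. Let $(\mu^i_\zeta)_{\zeta\in Z}$ be a pseudo-disintegration of $\mu^i$ over $\nu$: a family of non-zero measures on $X^i$ such that, for all $A\in\mathcal X^i$, $\zeta\mapsto\mu^i_\zeta(A)$ is $\nu$-measurable and $\mu^i(A)=\int_Z\mu^i_\zeta(A)\,d\nu(\zeta)$. For a family $(H_\zeta)$ of Hilbert spaces, a *space of $\nu$-measurable vector fields* is a linear subspace $S\subset\prod_\zeta H_\zeta$ such that: (a) $\zeta\mapsto\|u_\zeta\|$ is $\nu$-measurable for $u\in S$; (b) if $\zeta\mapsto\langle u_\zeta,v_\zeta\rangle$ is $\nu$-measurable for all $u\in S$, then $v\in S$; (c) there are $u_n\in S$, $n\in\mathbb N$, such that $(u_{n,\zeta})_n$ is total in $H_\zeta$ for $\nu$-a.e.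 $\zeta$. The direct integral $\int_Z^{\oplus}H_\zeta\,d\nu$ is the space of those $u\in S$ with $\int\|u_\zeta\|^2d\nu<\infty$, modulo $\nu$-a.e. equality. If $S^1,S^2$ are such spaces for two families, a field $\zeta\mapsto B_\zeta$ of bounded operators is $\nu$-measurable if it maps $S^1$ to $S^2$; if it is also $\nu$-essentially bounded, then $\int^\oplus B_\zeta\,d\nu$ is the operator $[u]\mapsto[(B_\zeta u_\zeta)_\zeta]$ between the direct integrals. For $f\in\mathcal L^2(\mu^i)$ let $\delta(f)_\zeta$ be the class of $f$ in $L^2(\mu^i_\zeta)$ if $f$ belongs to it, and $0$ otherwise. Let $\mathcal A^i$ be a linear space of functions in $\mathcal L^2(\mu^i)$ whose classes are dense in $L^2(\mu^i)$, let $S^i$ be the space of $\nu$-measurable vector fields in $\prod_\zeta L^2(\mu^i_\zeta)$ that contains $\delta(\mathcal A^i)$, and let $H^i=\int_Z^\oplus L^2(\mu^i_\zeta)\,d\nu(\zeta)$, ordered by: $h\ge0$ iff $h_\zeta\ge 0$ for $\nu$-a.e. $\zeta$. Let $\zeta\mapsto U_\zeta\colon L^2(\mu^1_\zeta)\to L^2(\mu^2_\zeta)$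 be a $\nu$-measurable, $\nu$-essentially bounded field of bounded operators and $U=\int^\oplus U_\zeta\,d\nu(\zeta)\colon H^1\to H^2$. Let $\zeta\mapsto Q^i_\zeta$ be a $\nu$-measurable field of densely defined closed non-negative quadratic forms on $L^2(\mu^i_\zeta)$ (the domains $D(Q^i_\zeta)$ with norm $(Q^i_\zeta(u)+\|u\|^2)^{1/2}$ carry a space of $\nu$-measurable vector fields contained in $S^i$), with semigroups $(T^i_{\zeta,t})_{t\ge0}$. **Proposition.** For every $t\geq 0$ the field $\zeta\mapsto T^i_{\zeta,t}$ is $\nu$-measurable and $\nu$-essentially bounded, so that $T^i_t=\int^\oplus T^i_{\zeta,t}\,d\nu(\zeta)$ is a bounded operator on $H^i$. Moreover: 1. $U$ is unitary iff $U_\zeta$ is unitary for $\nu$-a.e. $\zeta$, and in this case $U^{-1}=\int^\oplus U_\zeta^{-1}\,d\nu(\zeta)$. 2. $U$ is order-preserving ($f\ge0\Rightarrow Uf\ge0$) iff $U_\zeta$ is order-preserving for $\nu$-a.e. $\zeta$. 3. For each fixed $t$, $UT^1_t=T^2_tU$ iff $U_\zeta T^1_{\zeta,t}=T^2_{\zeta,t}U_\zeta$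 for $\nu$-a.e. $\zeta$. If $U$ is boundedly invertible, then for each $t$: $U$ intertwines $T^1_t$ and $T^2_t$ iff $U_\zeta$ intertwines $T^1_{\zeta,t}$ and $T^2_{\zeta,t}$ for $\nu$-a.e. $\zeta$, where "intertwines" means being boundedly invertible and satisfying the commutation relation. Moreover, $UT^1_t=T^2_tU$ for all $t\ge0$ iff, for $\nu$-a.e. $\zeta$, $U_\zeta T^1_{\zeta,t}=T^2_{\zeta,t}U_\zeta$ for all $t\ge0$. Suppose in addition that, for $i=1,2$, the pseudo-disintegration $(\mu^i_\zeta)$ is separated in a measurable way: there is a $\mu^i$-measurable map $s^i\colon X^i\to Z$ such that $\mu^i_\zeta$ is carried by $(s^i)^{-1}(\{\zeta\})$ for $\nu$-a.e. $\zeta$. Then there are surjective linear isometries $\iota^i\colon L^2(\mu^i)\to H^i$, $\iota^i[f]=[\delta(f)]$, and 1, 2 and 3 also hold, with the usual order of $L^2(\mu^i)$, for the bounded operator $(\iota^2)^{-1}U\iota^1\colon L^2(\mu^1)\to L^2(\mu^2)$ and the operators $(\iota^i)^{-1}T^i_t\iota^i$ on $L^2(\mu^i)$ in place of $U$ and $T^i_t$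 (and with $\iota^1,\iota^2$ applied correspondingly to $U^{-1}$). -/

import Mathlib

open MeasureTheory Filter Topology
open scoped NNReal ENNReal InnerProductSpace

noncomputable section

namespace DirInt

/-! ## Measurable fields of Hilbert spaces -/

section Fields

variable {Z : Type*} [MeasurableSpace Z]

/-- A space of `ν`-measurable vector fields for the family `H ζ`. For real-valued functions,
`AEMeasurable` is the same as measurability with respect to the `ν`-completed σ-algebra.
Totality of the fundamental sequence is only asked for `ν`-almost every `ζ`. -/
structure FieldSpace (ν : Measure Z) (H : Z → Type*) [∀ ζ, NormedAddCommGroup (H ζ)]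
    [∀ ζ, InnerProductSpace ℝ (H ζ)] where
  /-- the linear space of measurable vector fields -/
  carrier : Submodule ℝ (∀ ζ, H ζ)
  norm_meas : ∀ u ∈ carrier, AEMeasurable (fun ζ => ‖u ζ‖) ν
  mem_of_inner : ∀ v : ∀ ζ, H ζ,
    (∀ u ∈ carrier, AEMeasurable (fun ζ => ⟪u ζ, v ζ⟫_ℝ) ν) → v ∈ carrier
  exists_fundamental : ∃ u : ℕ → ∀ ζ, H ζ, (∀ n, u n ∈ carrier) ∧
    ∀ᵐ ζ ∂ν, (Submodule.span ℝ (Set.range fun n => u n ζ)).topologicalClosure = ⊤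

variable {ν : Measure Z} {H : Z → Type*} [∀ ζ, NormedAddCommGroup (H ζ)]
  [∀ ζ, InnerProductSpace ℝ (H ζ)]

lemma FieldSpace.inner_meas (S : FieldSpace ν H) {u v : ∀ ζ, H ζ} (hu : u ∈ S.carrier)
    (hv : v ∈ S.carrier) : AEMeasurable (fun ζ => ⟪u ζ, v ζ⟫_ℝ) ν := by
  have h1 := S.norm_meas _ (S.carrier.add_mem hu hv)
  have h2 := S.norm_meas _ (S.carrier.sub_mem hu hv)
  have h : (fun ζ => ⟪u ζ, v ζ⟫_ℝ) =
      fun ζ => (‖(u + v) ζ‖ * ‖(u + v) ζ‖ - ‖(u - v) ζ‖ * ‖(u - v) ζ‖) / 4 := by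
    funext ζ
    have h3 := norm_add_mul_self_real (u ζ) (v ζ)
    have h4 := norm_sub_mul_self_real (u ζ) (v ζ)
    simp only [Pi.add_apply, Pi.sub_apply]
    linarith
  rw [h]
  exact ((h1.mul h1).sub (h2.mul h2)).div_const 4

lemma FieldSpace.inner_integrable (S : FieldSpace ν H) {u v : ∀ ζ, H ζ} (hu : u ∈ S.carrier)
    (hv : v ∈ S.carrier) (hu2 : Integrable (fun ζ => ‖u ζ‖ ^ 2) ν)
    (hv2 : Integrable (fun ζ => ‖v ζ‖ ^ 2) ν) : Integrable (fun ζ => ⟪u ζ, v ζ⟫_ℝ) ν := by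
  refine (hu2.add hv2).mono' (S.inner_meas hu hv).aestronglyMeasurable
    (Eventually.of_forall fun ζ => ?_)
  have h := abs_real_inner_le_norm (u ζ) (v ζ)
  simp only [Real.norm_eq_abs, Pi.add_apply]
  nlinarith [sq_nonneg (‖u ζ‖ - ‖v ζ‖), sq_nonneg ‖u ζ‖, sq_nonneg ‖v ζ‖]

/-- The `ν`-square-integrable measurable vector fields. -/
def SqIntSubmodule (S : FieldSpace ν H) : Submodule ℝ (∀ ζ, H ζ) where
  carrier := {u | u ∈ S.carrier ∧ Integrable (fun ζ => ‖u ζ‖ ^ 2) ν}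
  zero_mem' := ⟨S.carrier.zero_mem, by simp⟩
  add_mem' := by
    rintro u v ⟨hu, hu2⟩ ⟨hv, hv2⟩
    have hm := S.norm_meas _ (S.carrier.add_mem hu hv)
    refine ⟨S.carrier.add_mem hu hv, ((hu2.add hv2).const_mul 2).mono'
      (hm.pow_const 2).aestronglyMeasurable (Eventually.of_forall fun ζ => ?_)⟩
    have h := norm_add_le (u ζ) (v ζ)
    simp only [Pi.add_apply, norm_pow, norm_norm]
    nlinarith [sq_nonneg (‖u ζ‖ - ‖v ζ‖), norm_nonneg (u ζ + v ζ), norm_nonneg (u ζ),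
      norm_nonneg (v ζ)]
  smul_mem' := by
    rintro c u ⟨hu, hu2⟩
    refine ⟨S.carrier.smul_mem c hu, ?_⟩
    have h : (fun ζ => ‖(c • u) ζ‖ ^ 2) = fun ζ => ‖c‖ ^ 2 * ‖u ζ‖ ^ 2 := by
      funext ζ
      simp only [Pi.smul_apply, norm_smul, mul_pow]
    rw [h]
    exact hu2.const_mul _

/-- The type of `ν`-square-integrable measurable vector fields. -/
def SqInt (S : FieldSpace ν H) : Type _ := SqIntSubmodule S

instance (S : FieldSpace ν H) : AddCommGroup (SqInt S) :=
  inferInstanceAs (AddCommGroup (SqIntSubmodule S))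

instance (S : FieldSpace ν H) : Module ℝ (SqInt S) :=
  inferInstanceAs (Module ℝ (SqIntSubmodule S))

instance (S : FieldSpace ν H) : CoeFun (SqInt S) fun _ => ∀ ζ, H ζ :=
  ⟨fun u => u.1⟩

/-- The semi-inner product `∫ ⟪u ζ, v ζ⟫ dν(ζ)` on square-integrable vector fields. -/
@[reducible] def sqIntCore (S : FieldSpace ν H) : PreInnerProductSpace.Core ℝ (SqInt S) where
  inner u v := ∫ ζ, ⟪u ζ, v ζ⟫_ℝ ∂ν
  conj_inner_symm u v := by
    simp only [conj_trivial]
    exact integral_congr_ae (Eventually.of_forall fun ζ => real_inner_comm _ _)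
  re_inner_nonneg u := by
    simp only [RCLike.re_to_real]
    exact integral_nonneg fun ζ => real_inner_self_nonneg
  add_left u v w := by
    have h1 := S.inner_integrable u.2.1 w.2.1 u.2.2 w.2.2
    have h2 := S.inner_integrable v.2.1 w.2.1 v.2.2 w.2.2
    rw [← integral_add h1 h2]
    exact integral_congr_ae (Eventually.of_forall fun ζ => inner_add_left _ _ _)
  smul_left u v r := by
    simp only [conj_trivial]
    rw [← integral_const_mul]
    exact integral_congr_ae (Eventually.of_forall fun ζ => real_inner_smul_left _ _ _)

instance (S : FieldSpace ν H) : SeminormedAddCommGroup (SqInt S) :=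
  @InnerProductSpace.Core.toSeminormedAddCommGroup ℝ (SqInt S) _ _ _ (sqIntCore S)

instance (S : FieldSpace ν H) : InnerProductSpace ℝ (SqInt S) :=
  InnerProductSpace.ofCore (sqIntCore S)

lemma SqInt.norm_sq {S : FieldSpace ν H} (u : SqInt S) : ‖u‖ ^ 2 = ∫ ζ, ‖u ζ‖ ^ 2 ∂ν := by
  rw [← real_inner_self_eq_norm_sq]
  exact integral_congr_ae (Eventually.of_forall fun ζ => real_inner_self_eq_norm_sq _)

/-- The direct integral `∫ H ζ dν(ζ)` with underlying space `S`: classes of square-integrable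
measurable vector fields modulo `‖u - v‖ = 0`, with the inner product `∫ ⟪u ζ, v ζ⟫ dν(ζ)`. -/
abbrev DirectIntegral (S : FieldSpace ν H) : Type _ := SeparationQuotient (SqInt S)

/-- The class of a square-integrable vector field in the direct integral. -/
abbrev cls {S : FieldSpace ν H} (u : SqInt S) : DirectIntegral S := SeparationQuotient.mk u

variable {K : Z → Type*} [∀ ζ, NormedAddCommGroup (K ζ)] [∀ ζ, InnerProductSpace ℝ (K ζ)]

/-- A `ν`-measurable, `ν`-essentially bounded field of bounded operators `B ζ : H ζ → K ζ`. -/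
structure IsOpField (S : FieldSpace ν H) (R : FieldSpace ν K) (B : ∀ ζ, H ζ →L[ℝ] K ζ) :
    Prop where
  meas : ∀ u ∈ S.carrier, (fun ζ => B ζ (u ζ)) ∈ R.carrier
  essBdd : ∃ C : ℝ, ∀ᵐ ζ ∂ν, ‖B ζ‖ ≤ C

variable {S : FieldSpace ν H} {R : FieldSpace ν K} {B : ∀ ζ, H ζ →L[ℝ] K ζ}

lemma IsOpField.bound (hB : IsOpField S R B) :
    ∃ C : ℝ, 0 ≤ C ∧ ∀ u : ∀ ζ, H ζ, ∀ᵐ ζ ∂ν, ‖B ζ (u ζ)‖ ^ 2 ≤ C ^ 2 * ‖u ζ‖ ^ 2 := by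
  obtain ⟨C, hC⟩ := hB.essBdd
  refine ⟨max C 0, le_max_right _ _, fun u => ?_⟩
  filter_upwards [hC] with ζ h
  rw [← mul_pow]
  refine pow_le_pow_left₀ (norm_nonneg _) ((B ζ).le_of_opNorm_le (h.trans (le_max_left _ _)) _) 2

lemma IsOpField.apply_mem (hB : IsOpField S R B) (u : SqInt S) :
    (fun ζ => B ζ (u ζ)) ∈ SqIntSubmodule R := by
  obtain ⟨C, -, hC⟩ := hB.bound
  refine ⟨hB.meas _ u.2.1, (u.2.2.const_mul (C ^ 2)).mono'
    ((R.norm_meas _ (hB.meas _ u.2.1)).pow_const 2).aestronglyMeasurable ?_⟩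
  filter_upwards [hC u] with ζ h
  simpa using h

/-- The pointwise action of an operator field on square-integrable vector fields. -/
def IsOpField.sqIntMap (hB : IsOpField S R B) : SqInt S →L[ℝ] SqInt R :=
  LinearMap.mkContinuousOfExistsBound
    { toFun := fun u => (⟨fun ζ => B ζ (u ζ), hB.apply_mem u⟩ : SqIntSubmodule R)
      map_add' := fun u v => Subtype.ext (funext fun ζ => map_add (B ζ) (u ζ) (v ζ))
      map_smul' := fun c u => Subtype.ext (funext fun ζ => map_smul (B ζ) c (u ζ)) }
    (by
      obtain ⟨C, hC0, hC⟩ := hB.bound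
      refine ⟨C, fun u => ?_⟩
      refine le_of_sq_le_sq ?_ (mul_nonneg hC0 (norm_nonneg _))
      rw [mul_pow, SqInt.norm_sq, SqInt.norm_sq, ← integral_const_mul]
      exact integral_mono_ae (hB.apply_mem u).2 (u.2.2.const_mul _) (hC u))

/-- The decomposable operator `∫ B ζ dν(ζ)` between direct integrals: it maps the class of
`ζ ↦ u ζ` to the class of `ζ ↦ B ζ (u ζ)`. -/
def dint (hB : IsOpField S R B) : DirectIntegral S →L[ℝ] DirectIntegral R :=
  SeparationQuotient.liftCLM
    ((SeparationQuotient.mkCLM ℝ (SqInt R)).comp hB.sqIntMap)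
    (fun _ _ h => SeparationQuotient.mk_eq_mk.2 (h.map hB.sqIntMap.continuous))

end Fields

/-! ## Unitary and intertwining operators -/

section Operators

variable {E F : Type*} [NormedAddCommGroup E] [InnerProductSpace ℝ E]
  [NormedAddCommGroup F] [InnerProductSpace ℝ F]

/-- A bounded operator is unitary if it is a surjective isometry. -/
def IsUnitary (U : E →L[ℝ] F) : Prop := (∀ x, ‖U x‖ = ‖x‖) ∧ Function.Surjective U

/-- The commutation relation `U A₁ = A₂ U` between bounded operators. -/
def Commutes (U : E →L[ℝ] F) (A₁ : E →L[ℝ] E) (A₂ : F →L[ℝ] F) : Prop :=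
  ∀ x, U (A₁ x) = A₂ (U x)

/-- `U` intertwines the (everywhere defined) bounded operators `A₁` and `A₂`: it is boundedly
invertible and `U A₁ = A₂ U`. -/
def Intertwines (U : E →L[ℝ] F) (A₁ : E →L[ℝ] E) (A₂ : F →L[ℝ] F) : Prop :=
  U.IsInvertible ∧ Commutes U A₁ A₂

end Operators

/-! ## Closed quadratic forms and their semigroups -/

section Forms

/-- A densely defined, closed, non-negative quadratic form on a real Hilbert space, given by its
domain and its symmetric bilinear form. -/
structure ClosedForm (H : Type*) [NormedAddCommGroup H] [InnerProductSpace ℝ H] where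
  /-- the domain -/
  domain : Submodule ℝ H
  /-- the bilinear form -/
  form : domain →ₗ[ℝ] domain →ₗ[ℝ] ℝ
  symm : ∀ u v, form u v = form v u
  nonneg : ∀ u, 0 ≤ form u u
  dense : Dense (domain : Set H)
  closed : ∀ (u : ℕ → domain) (x : H), Tendsto (fun n => (u n : H)) atTop (𝓝 x) →
    (∀ ε > 0, ∃ N, ∀ m ≥ N, ∀ n ≥ N, form (u m - u n) (u m - u n) < ε) →
    ∃ y : domain, (y : H) = x ∧ Tendsto (fun n => form (u n - y) (u n - y)) atTop (𝓝 0)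

variable {H : Type*} [NormedAddCommGroup H] [InnerProductSpace ℝ H]

/-- The domain of a closed form, as a Hilbert space with norm `(Q(u) + ‖u‖²)^{1/2}`. -/
def ClosedForm.Dom (Q : ClosedForm H) : Type _ := Q.domain

instance (Q : ClosedForm H) : AddCommGroup Q.Dom := inferInstanceAs (AddCommGroup Q.domain)

instance (Q : ClosedForm H) : Module ℝ Q.Dom := inferInstanceAs (Module ℝ Q.domain)

/-- The inclusion of the form domain in the ambient Hilbert space. -/
def ClosedForm.incl (Q : ClosedForm H) : Q.Dom →ₗ[ℝ] H := Q.domain.subtype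

/-- The inner product `Q(u, v) + ⟪u, v⟫` on the form domain. -/
@[reducible] def ClosedForm.core (Q : ClosedForm H) : InnerProductSpace.Core ℝ Q.Dom where
  inner u v := Q.form u v + ⟪Q.incl u, Q.incl v⟫_ℝ
  conj_inner_symm u v := by
    simp only [conj_trivial]
    rw [real_inner_comm]
    exact congrArg (· + _) (Q.symm v u)
  re_inner_nonneg u := by
    simp only [RCLike.re_to_real]
    exact add_nonneg (Q.nonneg u) real_inner_self_nonneg
  add_left u v w := by
    rw [map_add, inner_add_left]
    have h : Q.form (u + v) w = Q.form u w + Q.form v w := by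
      have := LinearMap.map_add₂ Q.form u v w
      exact this
    rw [add_add_add_comm, ← h]
  smul_left u v r := by
    simp only [conj_trivial]
    rw [map_smul, real_inner_smul_left, mul_add]
    have h : Q.form (r • u) v = r * Q.form u v := LinearMap.map_smul₂ Q.form r u v
    rw [← h]
  definite u hu := by
    have h1 := Q.nonneg u
    have h2 : 0 ≤ ⟪Q.incl u, Q.incl u⟫_ℝ := real_inner_self_nonneg
    have h3 : Q.form u u + ⟪Q.incl u, Q.incl u⟫_ℝ = 0 := hu
    have h4 : Q.incl u = 0 := by
      rw [← inner_self_eq_zero (𝕜 := ℝ)]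
      linarith
    exact Subtype.ext h4

instance (Q : ClosedForm H) : NormedAddCommGroup Q.Dom :=
  @InnerProductSpace.Core.toNormedAddCommGroup ℝ Q.Dom _ _ _ Q.core

instance (Q : ClosedForm H) : InnerProductSpace ℝ Q.Dom :=
  InnerProductSpace.ofCore Q.core.toCore

/-- `T` is the semigroup `exp (t L)` of the closed form `Q`: the strongly continuous contraction
semigroup whose generator is the operator `L` of `Q`, that is, `u ∈ dom L` with `L u = w` if and
only if `u ∈ dom Q` and `Q(u, v) = -⟪w, v⟫` for all `v ∈ dom Q`. -/
structure IsSemigroupOf (Q : ClosedForm H) (T : ℝ≥0 → H →L[ℝ] H) : Prop where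
  zero : T 0 = ContinuousLinearMap.id ℝ H
  add : ∀ s t, T (s + t) = (T s).comp (T t)
  contraction : ∀ t, ‖T t‖ ≤ 1
  continuous : ∀ u, Continuous fun t => T t u
  generator : ∀ u w : H,
    Tendsto (fun t : ℝ≥0 => (t : ℝ)⁻¹ • (T t u - u)) (𝓝[≠] 0) (𝓝 w) ↔
      ∃ hu : u ∈ Q.domain, ∀ v : Q.domain, Q.form ⟨u, hu⟩ v = -⟪w, (v : H)⟫_ℝ

/-- `ζ ↦ Q ζ` is a `ν`-measurable field of (closed) quadratic forms on the measurable field of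
Hilbert spaces with underlying space `S`: the form domains, with the form norms, are a measurable
field of Hilbert spaces with some underlying space contained in `S`. -/
def IsFormField {Z : Type*} [MeasurableSpace Z] {ν : Measure Z} {H : Z → Type*}
    [∀ ζ, NormedAddCommGroup (H ζ)] [∀ ζ, InnerProductSpace ℝ (H ζ)]
    (S : FieldSpace ν H) (Q : ∀ ζ, ClosedForm (H ζ)) : Prop :=
  ∃ SQ : FieldSpace ν (fun ζ => (Q ζ).Dom),
    ∀ u ∈ SQ.carrier, (fun ζ => (Q ζ).incl (u ζ)) ∈ S.carrier

end Forms

/-! ## Pseudo-disintegrations and direct integrals of `L²`-spaces -/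

section Disintegration

variable {X Z : Type*} [MeasurableSpace X] [MeasurableSpace Z]

/-- A σ-finite measure space is standard if it has a conegligible measurable subset that is a
standard Borel space. -/
def IsSigmaFiniteStandard (μ : Measure X) : Prop :=
  SigmaFinite μ ∧ ∃ X₀ : Set X, MeasurableSet X₀ ∧ μ X₀ᶜ = 0 ∧ StandardBorelSpace X₀

/-- A pseudo-disintegration of `μ` over `ν`. -/
structure IsPseudoDisintegration (μ : Measure X) (ν : Measure Z) (μf : Z → Measure X) :
    Prop where
  ne_zero : ∀ ζ, μf ζ ≠ 0
  meas : ∀ A, MeasurableSet A → AEMeasurable (fun ζ => μf ζ A) ν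
  eq_lintegral : ∀ A, MeasurableSet A → μ A = ∫⁻ ζ, μf ζ A ∂ν

/-- The pseudo-disintegration is separated by a `μ`-measurable map `s : X → Z`: the (pairwise
disjoint) fibres of `s` carry the measures `μf ζ`. -/
def IsMeasurablySeparated (μ : Measure X) (ν : Measure Z) (μf : Z → Measure X) : Prop :=
  ∃ s : X → Z, NullMeasurable s μ ∧ ∀ᵐ ζ ∂ν, μf ζ (s ⁻¹' {ζ})ᶜ = 0

open Classical in
/-- The diagonal embedding `δ`: the class of `f` in each `L²(μf ζ)` to which `f` belongs, and
zero in the others. -/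
def diag (μf : Z → Measure X) (f : X → ℝ) (ζ : Z) : Lp ℝ 2 (μf ζ) :=
  if h : MemLp f 2 (μf ζ) then h.toLp f else 0

/-- The space of measurable vector fields `S` is the one generated by a linear space `𝒜` of
square-integrable functions whose classes are dense in `L²(μ)`, through the diagonal embedding. -/
structure IsGeneratedBy (μ : Measure X) {ν : Measure Z} {μf : Z → Measure X}
    (S : FieldSpace ν (fun ζ => Lp ℝ 2 (μf ζ))) (𝒜 : Submodule ℝ (X → ℝ)) : Prop where
  memLp : ∀ f ∈ 𝒜, MemLp f 2 μ
  dense : Dense {g : Lp ℝ 2 μ | ∃ f ∈ 𝒜, ∃ h : MemLp f 2 μ, h.toLp f = g}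
  diag_mem : ∀ f ∈ 𝒜, diag μf f ∈ S.carrier

/-- The order on the direct integral of `L²`-spaces: `h ≥ 0` iff `h ζ ≥ 0` for a.e. `ζ`. -/
def IsNonneg {ν : Measure Z} {μf : Z → Measure X} {S : FieldSpace ν (fun ζ => Lp ℝ 2 (μf ζ))}
    (h : DirectIntegral S) : Prop :=
  ∃ u : SqInt S, cls u = h ∧ ∀ᵐ ζ ∂ν, 0 ≤ u ζ

/-- A bounded operator between `L²`-spaces is order-preserving. -/
def IsOrderPreserving {Y : Type*} [MeasurableSpace Y] {μ : Measure X} {μ' : Measure Y}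
    (U : Lp ℝ 2 μ →L[ℝ] Lp ℝ 2 μ') : Prop :=
  ∀ f, 0 ≤ f → 0 ≤ U f

/-- `ι` is the canonical identification of `L²(μ)` with the direct integral of the `L²(μf ζ)`:
it maps the class of every `f` to the class of `δ f`. -/
def IsCanonical {μ : Measure X} {ν : Measure Z} {μf : Z → Measure X}
    {S : FieldSpace ν (fun ζ => Lp ℝ 2 (μf ζ))} (ι : Lp ℝ 2 μ ≃ₗᵢ[ℝ] DirectIntegral S) : Prop :=
  ∀ (f : X → ℝ) (hf : MemLp f 2 μ), ∃ u : SqInt S, ι (hf.toLp f) = cls u ∧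
    ∀ᵐ ζ ∂ν, u ζ = diag μf f ζ

/-- The operator `ι₂⁻¹ B ι₁` obtained from `B` through identifications `ι₁` and `ι₂`. -/
def pull {E₁ E₂ F₁ F₂ : Type*} [NormedAddCommGroup E₁] [InnerProductSpace ℝ E₁]
    [NormedAddCommGroup E₂] [InnerProductSpace ℝ E₂] [NormedAddCommGroup F₁]
    [InnerProductSpace ℝ F₁] [NormedAddCommGroup F₂] [InnerProductSpace ℝ F₂]
    (ι₁ : E₁ ≃ₗᵢ[ℝ] F₁) (ι₂ : E₂ ≃ₗᵢ[ℝ] F₂) (B : F₁ →L[ℝ] F₂) : E₁ →L[ℝ] E₂ :=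
  (ι₂.symm.toContinuousLinearEquiv : F₂ →L[ℝ] E₂).comp
    (B.comp (ι₁.toContinuousLinearEquiv : E₁ →L[ℝ] F₁))

end Disintegration

end DirInt

end

/-! A decomposable operator determines its field almost everywhere. Since `ν` is σ-finite, a
fundamental sequence can be rescaled to be square-integrable, and its rational combinations are
countably many fields with dense values in almost every fibre. Hence a closed condition on vectors
that holds a.e. along each square-integrable field holds on almost every entire fibre
(`ae_forall_of_closed`). So `dint` is injective modulo null sets (`dint_eq_iff`). It also respects
composition and adjoints, so commutation relations and the identities U*U = 1, UU* = 1 pass between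
`dint hU` and the fibres. Invertibility passes to the fibres because lower bounds for U and U*
localise, and together they give invertibility on a complete fibre. For all times at once, a
countable dense set of times and strong continuity suffice.

For the semigroups, let J be the inclusion of the form domain and L the operator of the form. Then
(1 - L)⁻¹ = J J* preserves measurable fields, hence so does (1 - hL)⁻¹, which is a power series in
it, and so does T t, the strong limit of (1 - (t/n)L)⁻ⁿ (`IsSemigroupOf.tendsto_implicitStep_pow`).

For the order, standardness gives a countable family of sets that is measure-dense for almost every
`μf ζ` (`exists_measureDense`); their indicators generate the positive cone, so positivity needs
only countably many tests. The same indicators are total in almost every fibre. If the fibre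
measures are separated by `s`, cutting a diagonal field down to `E ⊆ Z` amounts to multiplying the
function by the indicator of `s ⁻¹' E`; a field orthogonal to the image of L²(μ) is therefore
orthogonal to each indicator fibre by fibre, and vanishes. This gives surjectivity of the canonical
isometry. -/

namespace DirInt

/-! ### Measurable fields and decomposable operators -/

section FieldSpaces

variable {Z : Type*} [MeasurableSpace Z] {ν : Measure Z}
variable {H : Z → Type*} [∀ ζ, NormedAddCommGroup (H ζ)] [∀ ζ, InnerProductSpace ℝ (H ζ)]
variable {K : Z → Type*} [∀ ζ, NormedAddCommGroup (K ζ)] [∀ ζ, InnerProductSpace ℝ (K ζ)]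
variable {L : Z → Type*} [∀ ζ, NormedAddCommGroup (L ζ)] [∀ ζ, InnerProductSpace ℝ (L ζ)]

lemma FieldSpace.congr_ae (S : FieldSpace ν H) {u v : ∀ ζ, H ζ} (hu : u ∈ S.carrier)
    (h : ∀ᵐ ζ ∂ν, u ζ = v ζ) : v ∈ S.carrier := by
  refine S.mem_of_inner v fun w hw => (S.inner_meas hw hu).congr ?_
  filter_upwards [h] with ζ hζ
  rw [hζ]

lemma FieldSpace.mem_of_tendsto (S : FieldSpace ν H) {u : ℕ → ∀ ζ, H ζ} {v : ∀ ζ, H ζ}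
    (hu : ∀ n, u n ∈ S.carrier)
    (h : ∀ᵐ ζ ∂ν, Tendsto (fun n => u n ζ) atTop (𝓝 (v ζ))) : v ∈ S.carrier := by
  refine S.mem_of_inner v fun w hw =>
    aemeasurable_of_tendsto_metrizable_ae atTop (fun n => S.inner_meas hw (hu n)) ?_
  filter_upwards [h] with ζ hζ
  exact tendsto_const_nhds.inner hζ

lemma FieldSpace.smul_mem (S : FieldSpace ν H) {φ : Z → ℝ} {u : ∀ ζ, H ζ}
    (hφ : AEMeasurable φ ν) (hu : u ∈ S.carrier) : (fun ζ => φ ζ • u ζ) ∈ S.carrier := by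
  refine S.mem_of_inner _ fun w hw => ?_
  simp only [real_inner_smul_right]
  exact hφ.mul (S.inner_meas hw hu)

/-- A square-integrable field built from its two defining properties. -/
def SqInt.of {S : FieldSpace ν H} (u : ∀ ζ, H ζ) (hu : u ∈ S.carrier)
    (h : Integrable (fun ζ => ‖u ζ‖ ^ 2) ν) : SqInt S := ⟨u, hu, h⟩

lemma SqInt.sub_apply {S : FieldSpace ν H} (u v : SqInt S) (ζ : Z) :
    (u - v) ζ = u ζ - v ζ := rfl

lemma SqInt.add_apply {S : FieldSpace ν H} (u v : SqInt S) (ζ : Z) :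
    (u + v) ζ = u ζ + v ζ := rfl

lemma SqInt.smul_apply {S : FieldSpace ν H} (c : ℝ) (u : SqInt S) (ζ : Z) :
    (c • u) ζ = c • u ζ := rfl

lemma SqInt.inner_eq {S : FieldSpace ν H} (u v : SqInt S) :
    ⟪u, v⟫_ℝ = ∫ ζ, ⟪u ζ, v ζ⟫_ℝ ∂ν := rfl

/-- The restriction of a square-integrable field to a measurable set. -/
noncomputable def SqInt.indicator {S : FieldSpace ν H} (u : SqInt S) {A : Set Z}
    (hA : MeasurableSet A) : SqInt S :=
  SqInt.of (fun ζ => A.indicator (fun _ => (1 : ℝ)) ζ • u ζ)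
    (S.smul_mem ((measurable_const.indicator hA).aemeasurable) u.2.1) (by
      have h : (fun ζ => ‖A.indicator (fun _ => (1 : ℝ)) ζ • u ζ‖ ^ 2)
          = A.indicator (fun ζ => ‖u ζ‖ ^ 2) := by
        funext ζ
        by_cases hζ : ζ ∈ A <;> simp [hζ]
      rw [h]
      exact u.2.2.indicator hA)

lemma SqInt.indicator_apply {S : FieldSpace ν H} (u : SqInt S) {A : Set Z}
    (hA : MeasurableSet A) (ζ : Z) :
    (u.indicator hA) ζ = A.indicator (fun _ => (1 : ℝ)) ζ • u ζ := rfl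

lemma cls_eq_iff {S : FieldSpace ν H} {u v : SqInt S} :
    cls u = cls v ↔ ∀ᵐ ζ ∂ν, u ζ = v ζ := by
  rw [SeparationQuotient.mk_eq_mk, Metric.inseparable_iff, dist_eq_norm,
    ← sq_eq_zero_iff, SqInt.norm_sq, integral_eq_zero_iff_of_nonneg (fun _ => sq_nonneg _)
      (u - v).2.2]
  refine eventually_congr (Eventually.of_forall fun ζ => ?_)
  simp only [Pi.zero_apply, sq_eq_zero_iff, norm_eq_zero]
  rw [SqInt.sub_apply, sub_eq_zero]

lemma norm_cls {S : FieldSpace ν H} (u : SqInt S) : ‖cls u‖ = ‖u‖ :=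
  SeparationQuotient.norm_mk u

lemma DirectIntegral.exists_cls {S : FieldSpace ν H} (x : DirectIntegral S) :
    ∃ u : SqInt S, cls u = x := SeparationQuotient.surjective_mk x

/-- Rational combinations of a total sequence are dense. -/
lemma denseRange_ratCombination {E : Type*} [NormedAddCommGroup E] [NormedSpace ℝ E]
    (e : ℕ → E) (he : (Submodule.span ℝ (Set.range e)).topologicalClosure = ⊤) :
    DenseRange (fun c : ℕ →₀ ℚ => c.sum fun k q => (q : ℝ) • e k) := by
  classical
  set D := Set.range (fun c : ℕ →₀ ℚ => c.sum fun k q => (q : ℝ) • e k) with hD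
  -- The closure of the rational combinations is already a real subspace, because ℚ is dense in ℝ
  -- and scalar multiplication is jointly continuous.
  let N : Submodule ℝ E :=
    { carrier := closure D
      zero_mem' := subset_closure ⟨0, by simp⟩
      add_mem' := fun {x y} hx hy => by
        refine map_mem_closure₂ continuous_add hx hy ?_
        rintro _ ⟨c, rfl⟩ _ ⟨d, rfl⟩
        refine ⟨c + d, ?_⟩
        exact Finsupp.sum_add_index' (by simp) (by intros; simp [add_smul])
      smul_mem' := fun r x hx => by
        refine map_mem_closure₂ (f := fun (r : ℝ) (x : E) => r • x) continuous_smul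
          (Rat.denseRange_cast r) hx ?_
        rintro _ ⟨q, rfl⟩ _ ⟨c, rfl⟩
        refine ⟨q • c, ?_⟩
        simp only
        rw [Finsupp.sum_smul_index' (by simp), Finsupp.smul_sum]
        simp [mul_smul] }
  have h1 : Submodule.span ℝ (Set.range e) ≤ N := by
    rw [Submodule.span_le]
    rintro _ ⟨k, rfl⟩
    exact subset_closure ⟨Finsupp.single k 1, by simp⟩
  have h2 := Submodule.topologicalClosure_minimal _ h1 isClosed_closure
  rw [he] at h2
  exact fun x => h2 (Submodule.mem_top (x := x))

lemma exists_sqInt_fundamental [SigmaFinite ν] (S : FieldSpace ν H) :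
    ∃ e : ℕ → SqInt S,
      ∀ᵐ ζ ∂ν, (Submodule.span ℝ (Set.range fun n => e n ζ)).topologicalClosure = ⊤ := by
  obtain ⟨u, hu, hu'⟩ := S.exists_fundamental
  obtain ⟨g, hg0, hgm, hgi⟩ := exists_pos_lintegral_lt_of_sigmaFinite ν one_ne_zero
  have hgint : Integrable (fun ζ => (g ζ : ℝ)) ν := by
    refine ⟨hgm.coe_nnreal_real.aestronglyMeasurable, ?_⟩
    refine lt_of_eq_of_lt (lintegral_congr fun ζ => ?_) (hgi.trans ENNReal.one_lt_top)
    simp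
  -- With `g` positive and integrable, φₙ‖uₙ‖ ≤ √g is square-integrable; as φₙ never vanishes, the
  -- fibrewise spans are unchanged.
  let φ : ℕ → Z → ℝ := fun n ζ => Real.sqrt (g ζ) / (1 + ‖u n ζ‖)
  have hφ : ∀ n, AEMeasurable (φ n) ν := fun n =>
    hgm.coe_nnreal_real.sqrt.aemeasurable.div ((S.norm_meas _ (hu n)).const_add 1)
  have hφ0 : ∀ n ζ, φ n ζ ≠ 0 := fun n ζ =>
    (div_pos (Real.sqrt_pos.2 (NNReal.coe_pos.2 (hg0 ζ))) (by positivity)).ne'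
  have hmem : ∀ n, (fun ζ => φ n ζ • u n ζ) ∈ S.carrier := fun n => S.smul_mem (hφ n) (hu n)
  have hint : ∀ n, Integrable (fun ζ => ‖φ n ζ • u n ζ‖ ^ 2) ν := fun n => by
    refine hgint.mono' ((S.norm_meas _ (hmem n)).pow_const 2).aestronglyMeasurable
      (Eventually.of_forall fun ζ => ?_)
    have h1 : 0 < 1 + ‖u n ζ‖ := by positivity
    rw [Real.norm_of_nonneg (by positivity), norm_smul, mul_pow, Real.norm_eq_abs, sq_abs,
      div_pow, Real.sq_sqrt (g ζ).coe_nonneg, div_mul_eq_mul_div, div_le_iff₀ (by positivity)]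
    refine mul_le_mul_of_nonneg_left ?_ (g ζ).coe_nonneg
    nlinarith [norm_nonneg (u n ζ)]
  refine ⟨fun n => SqInt.of _ (hmem n) (hint n), ?_⟩
  filter_upwards [hu'] with ζ hζ
  rw [← top_le_iff, ← hζ]
  refine Submodule.topologicalClosure_mono (Submodule.span_le.2 ?_)
  rintro _ ⟨n, rfl⟩
  have h : u n ζ = (φ n ζ)⁻¹ • (φ n ζ • u n ζ) := by
    rw [smul_smul, inv_mul_cancel₀ (hφ0 n ζ), one_smul]
  simp only [SetLike.mem_coe]
  rw [h]
  exact Submodule.smul_mem _ _ (Submodule.subset_span ⟨n, rfl⟩)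

lemma SqInt.ratCombination_apply {S : FieldSpace ν H} (e : ℕ → SqInt S) (c : ℕ →₀ ℚ) (ζ : Z) :
    (c.sum fun k q => (q : ℝ) • e k) ζ = c.sum fun k q => (q : ℝ) • (e k ζ) := by
  let ev : SqInt S →+ H ζ := ⟨⟨fun u => u ζ, rfl⟩, fun _ _ => rfl⟩
  exact map_finsuppSum ev c _

lemma exists_sqInt_dense [SigmaFinite ν] (S : FieldSpace ν H) :
    ∃ d : ℕ → SqInt S, ∀ᵐ ζ ∂ν, DenseRange (fun n => d n ζ) := by
  obtain ⟨e, he⟩ := exists_sqInt_fundamental S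
  obtain ⟨enum, henum⟩ := exists_surjective_nat (ℕ →₀ ℚ)
  refine ⟨fun n => (enum n).sum fun k q => (q : ℝ) • e k, ?_⟩
  filter_upwards [he] with ζ hζ
  have h := denseRange_ratCombination _ hζ
  simp only [SqInt.ratCombination_apply]
  rw [DenseRange, ← henum.range_comp] at h
  exact h

/-- A pointwise closed property that holds a.e. along each square-integrable field holds on
almost every fibre. -/
lemma ae_forall_of_closed [SigmaFinite ν] (S : FieldSpace ν H) (P : ∀ ζ, H ζ → Prop)
    (hP : ∀ᵐ ζ ∂ν, IsClosed {x | P ζ x}) (h : ∀ u : SqInt S, ∀ᵐ ζ ∂ν, P ζ (u ζ)) :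
    ∀ᵐ ζ ∂ν, ∀ x, P ζ x := by
  obtain ⟨d, hd⟩ := exists_sqInt_dense S
  filter_upwards [hP, hd, ae_all_iff.2 fun n => h (d n)] with ζ h1 h2 h3 x
  have h4 : Set.range (fun n => d n ζ) ⊆ {x | P ζ x} := by
    rintro _ ⟨n, rfl⟩
    exact h3 n
  exact closure_minimal h4 h1 (h2 x)

variable {S : FieldSpace ν H} {R : FieldSpace ν K} {W : FieldSpace ν L}

lemma dint_cls {B : ∀ ζ, H ζ →L[ℝ] K ζ} (hB : IsOpField S R B) (u : SqInt S) :
    dint hB (cls u) = cls (hB.sqIntMap u) := rfl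

lemma IsOpField.sqIntMap_apply {B : ∀ ζ, H ζ →L[ℝ] K ζ} (hB : IsOpField S R B) (u : SqInt S)
    (ζ : Z) : (hB.sqIntMap u) ζ = B ζ (u ζ) := rfl

lemma IsOpField.comp {B : ∀ ζ, K ζ →L[ℝ] L ζ} {A : ∀ ζ, H ζ →L[ℝ] K ζ}
    (hB : IsOpField R W B) (hA : IsOpField S R A) :
    IsOpField S W (fun ζ => (B ζ).comp (A ζ)) where
  meas u hu := hB.meas _ (hA.meas u hu)
  essBdd := by
    obtain ⟨C, hC⟩ := hB.essBdd
    obtain ⟨D, hD⟩ := hA.essBdd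
    refine ⟨C * D, ?_⟩
    filter_upwards [hC, hD] with ζ h1 h2
    exact ((B ζ).opNorm_comp_le (A ζ)).trans
      (mul_le_mul h1 h2 (norm_nonneg _) ((norm_nonneg _).trans h1))

lemma dint_comp {B : ∀ ζ, K ζ →L[ℝ] L ζ} {A : ∀ ζ, H ζ →L[ℝ] K ζ}
    (hB : IsOpField R W B) (hA : IsOpField S R A) :
    dint (hB.comp hA) = (dint hB).comp (dint hA) := by
  ext x
  obtain ⟨u, rfl⟩ := x.exists_cls
  rfl

lemma IsOpField.id (S : FieldSpace ν H) :
    IsOpField S S (fun ζ => ContinuousLinearMap.id ℝ (H ζ)) where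
  meas _ hu := hu
  essBdd := ⟨1, Eventually.of_forall fun _ => ContinuousLinearMap.norm_id_le⟩

lemma dint_id (S : FieldSpace ν H) : dint (IsOpField.id S) = ContinuousLinearMap.id ℝ _ := by
  ext x
  obtain ⟨u, rfl⟩ := x.exists_cls
  rfl

lemma IsOpField.congr_ae {A B : ∀ ζ, H ζ →L[ℝ] K ζ} (hA : IsOpField S R A)
    (h : ∀ᵐ ζ ∂ν, A ζ = B ζ) : IsOpField S R B where
  meas u hu := by
    refine R.congr_ae (hA.meas u hu) ?_
    filter_upwards [h] with ζ hζ
    rw [hζ]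
  essBdd := by
    obtain ⟨C, hC⟩ := hA.essBdd
    refine ⟨C, ?_⟩
    filter_upwards [h, hC] with ζ hζ hC
    rwa [← hζ]

lemma dint_eq_iff [SigmaFinite ν] {A B : ∀ ζ, H ζ →L[ℝ] K ζ} (hA : IsOpField S R A)
    (hB : IsOpField S R B) : dint hA = dint hB ↔ ∀ᵐ ζ ∂ν, A ζ = B ζ := by
  constructor
  · intro h
    have h1 := ae_forall_of_closed S (fun ζ x => A ζ x = B ζ x)
      (Eventually.of_forall fun ζ => isClosed_eq (A ζ).continuous (B ζ).continuous) fun u => by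
        have h2 := congrArg (fun T => T (cls u)) h
        simp only [dint_cls, cls_eq_iff, IsOpField.sqIntMap_apply] at h2
        exact h2
    filter_upwards [h1] with ζ hζ
    exact ContinuousLinearMap.ext hζ
  · intro h
    ext x
    obtain ⟨u, rfl⟩ := x.exists_cls
    rw [dint_cls, dint_cls, cls_eq_iff]
    filter_upwards [h] with ζ hζ
    rw [IsOpField.sqIntMap_apply, IsOpField.sqIntMap_apply, hζ]

/-- Measurability is tested against inner products, and moving the adjoint across turns each test
into one for `B` itself. -/
lemma IsOpField.adjoint [∀ ζ, CompleteSpace (H ζ)] [∀ ζ, CompleteSpace (K ζ)]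
    {B : ∀ ζ, H ζ →L[ℝ] K ζ} (hB : IsOpField S R B) :
    IsOpField R S (fun ζ => (B ζ).adjoint) where
  meas v hv := by
    refine S.mem_of_inner _ fun u hu => ?_
    simp only [ContinuousLinearMap.adjoint_inner_right]
    exact R.inner_meas (hB.meas u hu) hv
  essBdd := by
    obtain ⟨C, hC⟩ := hB.essBdd
    refine ⟨C, ?_⟩
    filter_upwards [hC] with ζ hζ
    simpa using hζ

lemma dint_adjoint_inner [∀ ζ, CompleteSpace (H ζ)] [∀ ζ, CompleteSpace (K ζ)]
    {B : ∀ ζ, H ζ →L[ℝ] K ζ} (hB : IsOpField S R B) (x : DirectIntegral S)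
    (y : DirectIntegral R) : ⟪dint hB.adjoint y, x⟫_ℝ = ⟪y, dint hB x⟫_ℝ := by
  obtain ⟨u, rfl⟩ := x.exists_cls
  obtain ⟨v, rfl⟩ := y.exists_cls
  rw [dint_cls, dint_cls, SeparationQuotient.inner_mk_mk, SeparationQuotient.inner_mk_mk,
    SqInt.inner_eq, SqInt.inner_eq]
  refine integral_congr_ae (Eventually.of_forall fun ζ => ?_)
  exact ContinuousLinearMap.adjoint_inner_left _ _ _

/-- A lower bound of a decomposable operator holds on almost every fibre. -/
lemma ae_le_norm_apply_of_dint [SigmaFinite ν] {B : ∀ ζ, H ζ →L[ℝ] K ζ}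
    (hB : IsOpField S R B) {c : ℝ} (hc : 0 ≤ c) (h : ∀ x, c * ‖x‖ ≤ ‖dint hB x‖) :
    ∀ᵐ ζ ∂ν, ∀ x, c * ‖x‖ ≤ ‖B ζ x‖ := by
  refine ae_forall_of_closed S (fun ζ x => c * ‖x‖ ≤ ‖B ζ x‖)
    (Eventually.of_forall fun ζ => isClosed_le (by fun_prop) (by fun_prop)) fun u => ?_
  -- Applying the global bound to `u` cut off to each measurable set `A` compares the integrals over
  -- every `A`, hence the integrands a.e.
  have hle : (fun ζ => c ^ 2 * ‖u ζ‖ ^ 2) ≤ᵐ[ν] fun ζ => ‖B ζ (u ζ)‖ ^ 2 := by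
    refine ae_le_of_forall_setIntegral_le (u.2.2.const_mul _) (hB.apply_mem u).2
      fun A hA _ => ?_
    have h1 := h (cls (u.indicator hA))
    rw [dint_cls, norm_cls, norm_cls] at h1
    have h2 := pow_le_pow_left₀ (by positivity) h1 2
    rw [mul_pow, SqInt.norm_sq, SqInt.norm_sq, ← integral_const_mul] at h2
    rw [← integral_indicator hA, ← integral_indicator hA]
    have e1 : A.indicator (fun ζ => c ^ 2 * ‖u ζ‖ ^ 2)
        = fun ζ => c ^ 2 * ‖(u.indicator hA) ζ‖ ^ 2 := by
      funext ζ
      by_cases hζ : ζ ∈ A <;> simp [hζ, SqInt.indicator_apply]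
    have e2 : A.indicator (fun ζ => ‖B ζ (u ζ)‖ ^ 2)
        = fun ζ => ‖(hB.sqIntMap (u.indicator hA)) ζ‖ ^ 2 := by
      funext ζ
      by_cases hζ : ζ ∈ A <;> simp [hζ, SqInt.indicator_apply, IsOpField.sqIntMap_apply]
    rw [e1, e2]
    exact h2
  filter_upwards [hle] with ζ hζ
  rw [← mul_pow] at hζ
  exact le_of_sq_le_sq hζ (norm_nonneg _)

end FieldSpaces

/-! ### Unitarity and invertibility through adjoint pairs -/

section FormalAdjoints

variable {E F : Type*} [NormedAddCommGroup E] [InnerProductSpace ℝ E]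
  [NormedAddCommGroup F] [InnerProductSpace ℝ F]

/-- Only a formal adjoint is used, so that the criterion applies to direct integrals without an
appeal to their completeness. -/
lemma isUnitary_iff_of_formalAdjoint {A : E →L[ℝ] F} {A' : F →L[ℝ] E}
    (h : ∀ x y, ⟪A' y, x⟫_ℝ = ⟪y, A x⟫_ℝ) :
    IsUnitary A ↔ A'.comp A = ContinuousLinearMap.id ℝ E ∧
      A.comp A' = ContinuousLinearMap.id ℝ F := by
  constructor
  · rintro ⟨hn, hs⟩
    have h1 : ∀ x, A' (A x) = x := fun x => by
      refine ext_inner_right ℝ fun y => ?_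
      rw [h]
      exact LinearIsometry.inner_map_map (⟨A.toLinearMap, hn⟩ : E →ₗᵢ[ℝ] F) x y
    refine ⟨ContinuousLinearMap.ext h1, ContinuousLinearMap.ext fun y => ?_⟩
    obtain ⟨x, rfl⟩ := hs y
    simp [h1]
  · rintro ⟨h1, h2⟩
    refine ⟨fun x => ?_, fun y => ⟨A' y, congrArg (fun T => T y) h2⟩⟩
    have h3 : A' (A x) = x := congrArg (fun T => T x) h1
    have h4 := h x (A x)
    rw [h3, real_inner_self_eq_norm_sq, real_inner_self_eq_norm_sq] at h4
    exact ((sq_eq_sq₀ (norm_nonneg _) (norm_nonneg _)).1 h4).symm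

lemma exists_lower_bound_of_isInvertible {A : E →L[ℝ] F} {A' : F →L[ℝ] E}
    (h : ∀ x y, ⟪A' y, x⟫_ℝ = ⟪y, A x⟫_ℝ) (hA : A.IsInvertible) :
    ∃ c > 0, (∀ x, c * ‖x‖ ≤ ‖A x‖) ∧ ∀ y, c * ‖y‖ ≤ ‖A' y‖ := by
  obtain ⟨e, rfl⟩ := hA
  -- The added 1 keeps `C` positive even if the inverse is the zero operator.
  let C := ‖(e.symm : F →L[ℝ] E)‖ + 1
  have hC : 0 < C := by positivity
  have hb : ∀ y, ‖e.symm y‖ ≤ C * ‖y‖ := fun y =>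
    ((e.symm : F →L[ℝ] E).le_opNorm y).trans (by
      gcongr
      exact (lt_add_one _).le)
  refine ⟨C⁻¹, inv_pos.2 hC, fun x => ?_, fun y => ?_⟩
  · rw [inv_mul_le_iff₀ hC]
    simpa using hb (e x)
  · rw [inv_mul_le_iff₀ hC]
    rcases eq_or_ne y 0 with rfl | hy
    · simp
    -- ‖y‖² = ⟨y, A A⁻¹y⟩ = ⟨A'y, A⁻¹y⟩, so a bound for A⁻¹ bounds A' from below.
    have h1 : ‖y‖ * ‖y‖ = ⟪A' y, e.symm y⟫_ℝ := by
      rw [h, ← real_inner_self_eq_norm_mul_norm]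
      simp
    have h2 := real_inner_le_norm (A' y) (e.symm y)
    have h3 : ‖y‖ * ‖y‖ ≤ (C * ‖A' y‖) * ‖y‖ := by
      rw [h1]
      refine h2.trans ((mul_le_mul_of_nonneg_left (hb y) (norm_nonneg _)).trans (le_of_eq ?_))
      ring
    exact le_of_mul_le_mul_right h3 (norm_pos_iff.2 hy)

/-- The bound on `A` makes it injective with closed range; the bound on the adjoint makes the
orthogonal complement of the range trivial. -/
lemma isInvertible_of_lower_bound [CompleteSpace E] [CompleteSpace F] {A : E →L[ℝ] F} {c : ℝ}
    (hc : 0 < c) (h1 : ∀ x, c * ‖x‖ ≤ ‖A x‖) (h2 : ∀ y, c * ‖y‖ ≤ ‖A.adjoint y‖) :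
    A.IsInvertible := by
  have hanti : AntilipschitzWith (Real.toNNReal c⁻¹) A := by
    refine A.antilipschitz_of_bound fun x => ?_
    rw [Real.coe_toNNReal _ (inv_nonneg.2 hc.le), ← div_eq_inv_mul, le_div_iff₀ hc, mul_comm]
    exact h1 x
  have hker : A.ker = ⊥ := LinearMap.ker_eq_bot.2 hanti.injective
  have hcl : IsClosed (A.range : Set F) := by
    rw [LinearMap.coe_range]
    exact hanti.isClosed_range A.uniformContinuous
  have hrange : A.range = ⊤ := by
    have : CompleteSpace A.range := hcl.completeSpace_coe
    rw [← Submodule.orthogonal_eq_bot_iff, Submodule.eq_bot_iff]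
    intro y hy
    have h3 : A.adjoint y = 0 := by
      refine ext_inner_right ℝ fun x => ?_
      rw [ContinuousLinearMap.adjoint_inner_left, inner_zero_left, real_inner_comm]
      exact hy _ ⟨x, rfl⟩
    have h4 := h2 y
    rw [h3, norm_zero] at h4
    have h5 : ‖y‖ ≤ 0 := by
      by_contra hn
      exact absurd h4 (not_le.2 (mul_pos hc (not_le.1 hn)))
    exact norm_le_zero_iff.1 h5
  exact ⟨ContinuousLinearEquiv.ofBijective A hker hrange, rfl⟩

end FormalAdjoints

/-! ### Fibrewise criteria for decomposable operators -/

section Decomposable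

variable {Z : Type*} [MeasurableSpace Z] {ν : Measure Z} [SigmaFinite ν]
variable {H : Z → Type*} [∀ ζ, NormedAddCommGroup (H ζ)] [∀ ζ, InnerProductSpace ℝ (H ζ)]
variable {K : Z → Type*} [∀ ζ, NormedAddCommGroup (K ζ)] [∀ ζ, InnerProductSpace ℝ (K ζ)]
variable {S : FieldSpace ν H} {R : FieldSpace ν K} {U : ∀ ζ, H ζ →L[ℝ] K ζ}

theorem commutes_dint_iff (hU : IsOpField S R U) {A : ∀ ζ, H ζ →L[ℝ] H ζ}
    {B : ∀ ζ, K ζ →L[ℝ] K ζ} (hA : IsOpField S S A) (hB : IsOpField R R B) :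
    Commutes (dint hU) (dint hA) (dint hB) ↔ ∀ᵐ ζ ∂ν, Commutes (U ζ) (A ζ) (B ζ) := by
  have h1 : Commutes (dint hU) (dint hA) (dint hB) ↔
      dint (hU.comp hA) = dint (hB.comp hU) := by
    rw [dint_comp hU hA, dint_comp hB hU]
    exact ⟨fun h => ContinuousLinearMap.ext h, fun h x => congrArg (fun T => T x) h⟩
  rw [h1, dint_eq_iff (hU.comp hA) (hB.comp hU)]
  refine eventually_congr (Eventually.of_forall fun ζ => ?_)
  exact ⟨fun h x => congrArg (fun T => T x) h, fun h => ContinuousLinearMap.ext h⟩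

theorem forall_commutes_dint_iff (hU : IsOpField S R U) {A : ∀ ζ, ℝ≥0 → H ζ →L[ℝ] H ζ}
    {B : ∀ ζ, ℝ≥0 → K ζ →L[ℝ] K ζ} (hA : ∀ t, IsOpField S S (fun ζ => A ζ t))
    (hB : ∀ t, IsOpField R R (fun ζ => B ζ t)) (hAc : ∀ ζ u, Continuous fun t => A ζ t u)
    (hBc : ∀ ζ u, Continuous fun t => B ζ t u) :
    (∀ t, Commutes (dint hU) (dint (hA t)) (dint (hB t))) ↔
      ∀ᵐ ζ ∂ν, ∀ t, Commutes (U ζ) (A ζ t) (B ζ t) := by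
  simp only [commutes_dint_iff]
  constructor
  · intro h
    filter_upwards [ae_all_iff.2 fun n => h (TopologicalSpace.denseSeq ℝ≥0 n)] with ζ hζ t x
    have hcl : IsClosed {t : ℝ≥0 | U ζ (A ζ t x) = B ζ t (U ζ x)} :=
      isClosed_eq ((U ζ).continuous.comp (hAc ζ x)) (hBc ζ (U ζ x))
    refine closure_minimal ?_ hcl (TopologicalSpace.denseRange_denseSeq ℝ≥0 t)
    rintro _ ⟨n, rfl⟩
    exact hζ n x
  · intro h t
    filter_upwards [h] with ζ hζ
    exact hζ t

variable [∀ ζ, CompleteSpace (H ζ)] [∀ ζ, CompleteSpace (K ζ)]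

lemma adjoint_formalAdjoint {E F : Type*} [NormedAddCommGroup E] [InnerProductSpace ℝ E]
    [NormedAddCommGroup F] [InnerProductSpace ℝ F] [CompleteSpace E] [CompleteSpace F]
    (A : E →L[ℝ] F) (x : E) (y : F) : ⟪A.adjoint y, x⟫_ℝ = ⟪y, A x⟫_ℝ :=
  ContinuousLinearMap.adjoint_inner_left _ _ _

theorem isUnitary_dint_iff (hU : IsOpField S R U) :
    IsUnitary (dint hU) ↔ ∀ᵐ ζ ∂ν, IsUnitary (U ζ) := by
  rw [isUnitary_iff_of_formalAdjoint (dint_adjoint_inner hU), ← dint_comp, ← dint_comp,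
    ← dint_id, ← dint_id, dint_eq_iff, dint_eq_iff, ← eventually_and]
  refine eventually_congr (Eventually.of_forall fun ζ => ?_)
  exact (isUnitary_iff_of_formalAdjoint (adjoint_formalAdjoint (U ζ))).symm

/-- The field of inverses is measurable because it agrees a.e. with the field of adjoints. On the
exceptional null set `inverse` may take its default value 0. -/
theorem dint_inverse_of_isUnitary (hU : IsOpField S R U) (h : IsUnitary (dint hU)) :
    ∃ hI : IsOpField R S (fun ζ => (U ζ).inverse),
      (dint hI).comp (dint hU) = ContinuousLinearMap.id ℝ _ ∧
      (dint hU).comp (dint hI) = ContinuousLinearMap.id ℝ _ := by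
  have h1 : ∀ᵐ ζ ∂ν, (U ζ).adjoint = (U ζ).inverse := by
    filter_upwards [(isUnitary_dint_iff hU).1 h] with ζ hζ
    obtain ⟨h2, h3⟩ := (isUnitary_iff_of_formalAdjoint (adjoint_formalAdjoint (U ζ))).1 hζ
    exact (ContinuousLinearMap.inverse_eq h3 h2).symm
  have hI := hU.adjoint.congr_ae h1
  refine ⟨hI, ?_⟩
  rw [← (dint_eq_iff hU.adjoint hI).2 h1]
  exact (isUnitary_iff_of_formalAdjoint (dint_adjoint_inner hU)).1 h

/-- The measurability of the fibre inverses is not known beforehand; one constant bounding the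
operator and its formal adjoint from below is localised instead. -/
theorem ae_isInvertible_of_dint (hU : IsOpField S R U) (h : (dint hU).IsInvertible) :
    ∀ᵐ ζ ∂ν, (U ζ).IsInvertible := by
  obtain ⟨c, hc, h1, h2⟩ := exists_lower_bound_of_isInvertible (dint_adjoint_inner hU) h
  filter_upwards [ae_le_norm_apply_of_dint hU hc.le h1,
    ae_le_norm_apply_of_dint hU.adjoint hc.le h2] with ζ h3 h4
  exact isInvertible_of_lower_bound hc h3 h4

theorem intertwines_dint_iff (hU : IsOpField S R U) (h : (dint hU).IsInvertible)
    {A : ∀ ζ, H ζ →L[ℝ] H ζ} {B : ∀ ζ, K ζ →L[ℝ] K ζ} (hA : IsOpField S S A)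
    (hB : IsOpField R R B) :
    Intertwines (dint hU) (dint hA) (dint hB) ↔ ∀ᵐ ζ ∂ν, Intertwines (U ζ) (A ζ) (B ζ) := by
  have h1 := ae_isInvertible_of_dint hU h
  simp only [Intertwines, h, true_and, commutes_dint_iff, eventually_and, h1]

end Decomposable

/-! ### Strong limits and powers of contractions -/

section Approximation

variable {E : Type*} [NormedAddCommGroup E] [NormedSpace ℝ E]

/-- Strong convergence of contractions extends from a dense set. -/
lemma tendsto_of_tendsto_on_dense {A : ℕ → E →L[ℝ] E} {B : E →L[ℝ] E} {D : Set E}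
    (hD : Dense D) (hA : ∀ᶠ n in atTop, ∀ x, ‖A n x‖ ≤ ‖x‖) (hB : ∀ x, ‖B x‖ ≤ ‖x‖)
    (h : ∀ x ∈ D, Tendsto (fun n => A n x) atTop (𝓝 (B x))) (x : E) :
    Tendsto (fun n => A n x) atTop (𝓝 (B x)) := by
  rw [Metric.tendsto_nhds]
  intro ε hε
  obtain ⟨y, hy, hxy⟩ := Metric.dense_iff.1 hD x (ε / 3) (by positivity)
  rw [Metric.mem_ball, dist_eq_norm] at hy
  filter_upwards [hA, Metric.tendsto_nhds.1 (h y hxy) (ε / 3) (by positivity)] with n h1 h2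
  rw [dist_eq_norm] at h2 ⊢
  have h3 : A n x - B x = (A n y - B y) - A n (y - x) + B (y - x) := by
    rw [map_sub, map_sub]
    abel
  rw [h3]
  have h4 := h1 (y - x)
  have h5 := hB (y - x)
  have h6 := norm_add_le ((A n y - B y) - A n (y - x)) (B (y - x))
  have h7 := norm_sub_le (A n y - B y) (A n (y - x))
  linarith

/-- Powers of commuting contractions. -/
lemma norm_pow_sub_pow_apply_le {A B : E →L[ℝ] E} (hA : ∀ x, ‖A x‖ ≤ ‖x‖)
    (hB : ∀ x, ‖B x‖ ≤ ‖x‖) (hAB : Commute A B) (x : E) (n : ℕ) :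
    ‖(A ^ n) x - (B ^ n) x‖ ≤ n * ‖A x - B x‖ := by
  have hAn : ∀ (n : ℕ) (x : E), ‖(A ^ n) x‖ ≤ ‖x‖ := by
    intro n
    induction n with
    | zero => simp
    | succ k ih =>
      intro x
      rw [pow_succ, mul_apply_eq_comp]
      exact (ih _).trans (hA x)
  induction n with
  | zero => simp
  | succ k ih =>
    have h1 : (A ^ k) (B x) = B ((A ^ k) x) :=
      congrArg (fun T : E →L[ℝ] E => T x) (hAB.pow_left k).eq
    -- One step of the telescoping of Aⁿ - Bⁿ; commutation moves B to the left so that it acts last,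
    -- as a contraction.
    have h2 : (A ^ (k + 1)) x - (B ^ (k + 1)) x
        = (A ^ k) (A x - B x) + B ((A ^ k) x - (B ^ k) x) := by
      rw [pow_succ, pow_succ', mul_apply_eq_comp, mul_apply_eq_comp,
        map_sub, map_sub, h1]
      abel
    rw [h2]
    refine (norm_add_le _ _).trans ?_
    have h3 := hAn k (A x - B x)
    have h4 := hB ((A ^ k) x - (B ^ k) x)
    rw [Nat.cast_succ, add_mul, one_mul]
    linarith

end Approximation

/-! ### The operator of a closed form and its resolvents -/

namespace ClosedForm

variable {H : Type*} [NormedAddCommGroup H] [InnerProductSpace ℝ H] (Q : ClosedForm H)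

lemma dom_inner_eq (u v : Q.Dom) :
    ⟪u, v⟫_ℝ = Q.form u v + ⟪Q.incl u, Q.incl v⟫_ℝ := rfl

lemma dom_norm_sq (u : Q.Dom) : ‖u‖ ^ 2 = Q.form u u + ‖Q.incl u‖ ^ 2 := by
  rw [← real_inner_self_eq_norm_sq, ← real_inner_self_eq_norm_sq]
  rfl

lemma norm_incl_le (u : Q.Dom) : ‖Q.incl u‖ ≤ 1 * ‖u‖ := by
  rw [one_mul]
  refine le_of_sq_le_sq ?_ (norm_nonneg _)
  rw [dom_norm_sq]
  linarith [Q.nonneg u]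

/-- The inclusion of the form domain as a bounded operator. -/
noncomputable def inclL : Q.Dom →L[ℝ] H := Q.incl.mkContinuous 1 Q.norm_incl_le

/-- This is closedness of the form; it is what gives the inclusion `inclL` an adjoint. -/
instance [CompleteSpace H] : CompleteSpace Q.Dom := by
  refine Metric.complete_of_cauchySeq_tendsto fun u hu => ?_
  have h1 : CauchySeq fun n => Q.incl (u n) :=
    (Q.inclL.uniformContinuous.comp_cauchySeq hu)
  obtain ⟨x, hx⟩ := cauchySeq_tendsto_of_complete h1
  have h2 : ∀ ε > 0, ∃ N, ∀ m ≥ N, ∀ n ≥ N, ‖u m - u n‖ ^ 2 < ε := by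
    intro ε hε
    obtain ⟨N, hN⟩ := Metric.cauchySeq_iff.1 hu (Real.sqrt ε) (Real.sqrt_pos.2 hε)
    refine ⟨N, fun m hm n hn => ?_⟩
    have h3 := hN m hm n hn
    rw [dist_eq_norm] at h3
    exact (Real.lt_sqrt (norm_nonneg _)).1 h3
  obtain ⟨y, hy, hy'⟩ : ∃ y : Q.Dom, Q.incl y = x ∧
      Tendsto (fun n => Q.form (u n - y : Q.Dom) (u n - y : Q.Dom)) atTop (𝓝 0) :=
    Q.closed u x hx fun ε hε => by
      obtain ⟨N, hN⟩ := h2 ε hε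
      refine ⟨N, fun m hm n hn => lt_of_le_of_lt ?_ (hN m hm n hn)⟩
      rw [dom_norm_sq]
      exact le_add_of_nonneg_right (sq_nonneg _)
  refine ⟨y, ?_⟩
  rw [tendsto_iff_norm_sub_tendsto_zero]
  have h4 : Tendsto (fun n => ‖Q.incl (u n) - x‖ ^ 2) atTop (𝓝 0) := by
    simpa using (tendsto_iff_norm_sub_tendsto_zero.1 hx).pow 2
  have h5 := hy'.add h4
  rw [add_zero] at h5
  have h6 : Tendsto (fun n => Real.sqrt (‖u n - y‖ ^ 2)) atTop (𝓝 0) := by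
    rw [← Real.sqrt_zero]
    refine (Real.continuous_sqrt.tendsto _).comp (h5.congr fun n => ?_)
    have h7 := Q.dom_norm_sq (u n - y)
    rw [map_sub] at h7
    rw [h7, ← hy]
  simpa [Real.sqrt_sq] using h6

/-- `Q.IsGen u w`: `u` is in the domain of the operator of `Q`, which maps it to `w`. -/
def IsGen (u w : H) : Prop :=
  ∃ hu : u ∈ Q.domain, ∀ v : Q.domain, Q.form ⟨u, hu⟩ v = -⟪w, (v : H)⟫_ℝ

variable {Q}

lemma IsGen.sub {u u' w w' : H} (h : Q.IsGen u w) (h' : Q.IsGen u' w') :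
    Q.IsGen (u - u') (w - w') := by
  obtain ⟨hu, h⟩ := h
  obtain ⟨hu', h'⟩ := h'
  refine ⟨Q.domain.sub_mem hu hu', fun v => ?_⟩
  have h1 : (⟨u - u', Q.domain.sub_mem hu hu'⟩ : Q.domain) = ⟨u, hu⟩ - ⟨u', hu'⟩ := rfl
  rw [h1, map_sub, LinearMap.sub_apply, h, h', inner_sub_left]
  ring

/-- Dissipativity: ⟨w, u⟩ = -Q(u, u) ≤ 0, so ‖u‖² ≤ ⟨u - r w, u⟩. It yields both uniqueness and
contractivity of (1 - rL)⁻¹. -/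
lemma IsGen.norm_le {u w : H} (h : Q.IsGen u w) {r : ℝ} (hr : 0 ≤ r) :
    ‖u‖ ≤ ‖u - r • w‖ := by
  obtain ⟨hu, h⟩ := h
  have h1 := h ⟨u, hu⟩
  have h2 := Q.nonneg ⟨u, hu⟩
  simp only at h1
  have h3 : ⟪u - r • w, u⟫_ℝ = ‖u‖ * ‖u‖ - r * ⟪w, u⟫_ℝ := by
    rw [inner_sub_left, real_inner_smul_left, real_inner_self_eq_norm_mul_norm]
  have h4 := real_inner_le_norm (u - r • w) u
  have h5 : 0 ≤ r * -⟪w, u⟫_ℝ := mul_nonneg hr (by linarith)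
  by_contra hn
  push Not at hn
  have h6 : 0 < ‖u‖ := (norm_nonneg _).trans_lt hn
  nlinarith

lemma IsGen.eq_of_sub_smul_eq {u u' w w' : H} (h : Q.IsGen u w) (h' : Q.IsGen u' w') {r : ℝ}
    (hr : 0 ≤ r) (he : u - r • w = u' - r • w') : u = u' := by
  have h1 := (h.sub h').norm_le hr
  have h2 : u - u' - r • (w - w') = 0 := by
    rw [smul_sub]
    rw [← sub_eq_zero] at he
    rw [← he]
    abel
  rw [h2, norm_zero] at h1
  exact sub_eq_zero.1 (norm_le_zero_iff.1 h1)

variable (Q) [CompleteSpace H]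

/-- The resolvent `(1 - L)⁻¹` of the operator `L` of a closed form. -/
noncomputable def res : H →L[ℝ] H := Q.inclL.comp Q.inclL.adjoint

lemma isGen_res (x : H) : Q.IsGen (Q.res x) (Q.res x - x) := by
  refine ⟨(Q.inclL.adjoint x : Q.domain).2, fun v => ?_⟩
  have h1 := Q.dom_inner_eq (Q.inclL.adjoint x) (show Q.Dom from v)
  rw [ContinuousLinearMap.adjoint_inner_left] at h1
  rw [inner_sub_left]
  have h2 : Q.form (Q.inclL.adjoint x) v = ⟪x, Q.incl v⟫_ℝ
      - ⟪Q.incl (Q.inclL.adjoint x), Q.incl v⟫_ℝ := by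
    rw [eq_sub_iff_add_eq]
    exact h1.symm
  refine Eq.trans h2 ?_
  rw [neg_sub]
  rfl

/-- With R = J J*, ⟨x, Rx⟩ = ‖J*x‖² ≥ ‖Rx‖²; expanding ‖x - Rx‖² gives the bound. -/
lemma norm_one_sub_res_le : ‖1 - Q.res‖ ≤ 1 := by
  refine ContinuousLinearMap.opNorm_le_bound _ zero_le_one fun x => ?_
  rw [one_mul]
  refine le_of_sq_le_sq ?_ (norm_nonneg _)
  have h1 : ⟪x, Q.res x⟫_ℝ = ‖Q.inclL.adjoint x‖ ^ 2 := by
    rw [res, ContinuousLinearMap.comp_apply, ← ContinuousLinearMap.adjoint_inner_left,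
      real_inner_self_eq_norm_sq]
  have h2 : ‖Q.res x‖ ≤ ‖Q.inclL.adjoint x‖ := by
    exact (Q.norm_incl_le (Q.inclL.adjoint x)).trans_eq (one_mul _)
  have h3 := norm_sub_sq_real x (Q.res x)
  rw [sub_apply, one_apply_eq_self, h3, h1]
  have h4 := pow_le_pow_left₀ (norm_nonneg _) h2 2
  nlinarith [sq_nonneg ‖Q.inclL.adjoint x‖]

/-- A vector y orthogonal to the range of R = J J* has ‖J*y‖² = ⟨Ry, y⟩ = 0, hence is orthogonal to
the dense form domain. -/
lemma dense_isGen : Dense {u | ∃ w, Q.IsGen u w} := by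
  have h1 : Set.range Q.res ⊆ {u | ∃ w, Q.IsGen u w} := by
    rintro _ ⟨x, rfl⟩
    exact ⟨_, Q.isGen_res x⟩
  refine Dense.mono h1 ?_
  have h2 : (Q.res.range).topologicalClosure = ⊤ := by
    rw [Submodule.topologicalClosure_eq_top_iff, Submodule.eq_bot_iff]
    intro y hy
    have h3 : ⟪Q.res y, y⟫_ℝ = 0 := hy _ ⟨y, rfl⟩
    rw [res, ContinuousLinearMap.comp_apply, ← ContinuousLinearMap.adjoint_inner_right,
      inner_self_eq_zero] at h3
    refine Q.dense.eq_zero_of_inner_right (𝕜 := ℝ) fun v hv => ?_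
    have h5 := ContinuousLinearMap.adjoint_inner_right Q.inclL (show Q.Dom from ⟨v, hv⟩) y
    rw [h3, inner_zero_right] at h5
    exact h5.symm
  intro x
  have h6 : x ∈ (Q.res.range).topologicalClosure := h2 ▸ Submodule.mem_top
  exact h6

/-- The operator `(1 - h L)⁻¹` for `0 < h ≤ 1`, as a power series in `1 - (1 - L)⁻¹`. -/
noncomputable def implicitStep (h : ℝ) : H →L[ℝ] H :=
  (∑' k : ℕ, ((1 - h) • (1 - Q.res)) ^ k) * Q.res

variable {h : ℝ}

lemma norm_smul_one_sub_res_lt (h0 : 0 < h) (h1 : h ≤ 1) : ‖(1 - h) • (1 - Q.res)‖ < 1 := by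
  rw [norm_smul, Real.norm_of_nonneg (by linarith)]
  have h2 := Q.norm_one_sub_res_le
  nlinarith [norm_nonneg (1 - Q.res)]

/-- Formally, R(1 - hL) = 1 - (1 - h)(1 - R) for R = (1 - L)⁻¹, and the right side is inverted by a
geometric series since ‖(1 - h)(1 - R)‖ < 1. -/
lemma isGen_implicitStep (h0 : 0 < h) (h1 : h ≤ 1) (x : H) :
    Q.IsGen (Q.implicitStep h x) (h⁻¹ • (Q.implicitStep h x - x)) := by
  have h2 : (1 - (1 - h) • (1 - Q.res)) * Q.implicitStep h = Q.res := by
    rw [implicitStep, ← mul_assoc, mul_neg_geom_series _ (Q.norm_smul_one_sub_res_lt h0 h1),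
      one_mul]
  have h3 := congrArg (fun T : H →L[ℝ] H => T x) h2
  set z := Q.implicitStep h x with hz
  have h4 : z - (1 - h) • (z - Q.res z) = Q.res x := by
    simpa [← hz] using h3
  -- Writing z as a value of the resolvent puts it in the domain of L and identifies Lz.
  have h5 : Q.res (h⁻¹ • (x - (1 - h) • z)) = z := by
    rw [map_smul, map_sub, map_smul, ← h4]
    have : z - (1 - h) • (z - Q.res z) - (1 - h) • Q.res z = h • z := by
      module
    rw [this, smul_smul, inv_mul_cancel₀ h0.ne', one_smul]
  have h6 := Q.isGen_res (h⁻¹ • (x - (1 - h) • z))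
  rw [h5] at h6
  convert h6 using 1
  have h7 : z = h⁻¹ • (h • z) := by rw [smul_smul, inv_mul_cancel₀ h0.ne', one_smul]
  nth_rewrite 2 [h7]
  module

lemma implicitStep_eq (h0 : 0 < h) (h1 : h ≤ 1) {x z w : H} (hz : Q.IsGen z w)
    (he : z - h • w = x) : Q.implicitStep h x = z := by
  refine (Q.isGen_implicitStep h0 h1 x).eq_of_sub_smul_eq hz h0.le ?_
  rw [he, smul_smul, mul_inv_cancel₀ h0.ne', one_smul]
  abel

lemma norm_implicitStep_apply_le (h0 : 0 < h) (h1 : h ≤ 1) (x : H) :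
    ‖Q.implicitStep h x‖ ≤ ‖x‖ := by
  have h2 := (Q.isGen_implicitStep h0 h1 x).norm_le h0.le
  rwa [smul_smul, mul_inv_cancel₀ h0.ne', one_smul, sub_sub_cancel] at h2

/-- The difference quotient of (1 - hL)⁻¹ at u is (1 - hL)⁻¹Lu, because (1 - hL)⁻¹(u - hLu) = u. -/
lemma implicitStep_sub (h0 : 0 < h) (h1 : h ≤ 1) {u w : H} (hu : Q.IsGen u w) :
    h⁻¹ • (Q.implicitStep h u - u) = Q.implicitStep h w := by
  have h2 := Q.implicitStep_eq h0 h1 hu rfl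
  rw [map_sub, map_smul, sub_eq_iff_eq_add] at h2
  rw [h2, add_sub_cancel_left, smul_smul, inv_mul_cancel₀ h0.ne', one_smul]

lemma tendsto_implicitStep {r : ℕ → ℝ} (hr : Tendsto r atTop (𝓝 0))
    (hr' : ∀ᶠ n in atTop, 0 < r n ∧ r n ≤ 1) (x : H) :
    Tendsto (fun n => Q.implicitStep (r n) x) atTop (𝓝 x) := by
  refine tendsto_of_tendsto_on_dense (B := ContinuousLinearMap.id ℝ H) Q.dense_isGen ?_
    (fun _ => le_rfl) ?_ x
  · filter_upwards [hr'] with n hn x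
    exact Q.norm_implicitStep_apply_le hn.1 hn.2 x
  · rintro u ⟨w, hu⟩
    rw [tendsto_iff_norm_sub_tendsto_zero]
    have h2 : Tendsto (fun n => r n * ‖w‖) atTop (𝓝 0) := by simpa using hr.mul_const ‖w‖
    refine squeeze_zero' (Eventually.of_forall fun _ => norm_nonneg _) ?_ h2
    filter_upwards [hr'] with n hn
    have h3 := Q.implicitStep_sub hn.1 hn.2 hu
    have h4 : Q.implicitStep (r n) u - u = r n • Q.implicitStep (r n) w := by
      rw [← h3, smul_smul, mul_inv_cancel₀ hn.1.ne', one_smul]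
    rw [ContinuousLinearMap.id_apply, h4, norm_smul, Real.norm_of_nonneg hn.1.le]
    exact mul_le_mul_of_nonneg_left (Q.norm_implicitStep_apply_le hn.1 hn.2 w) hn.1.le

end ClosedForm

/-! ### The exponential formula -/

section Semigroups

variable {H : Type*} [NormedAddCommGroup H] [InnerProductSpace ℝ H] {Q : ClosedForm H}
  {T : ℝ≥0 → H →L[ℝ] H}

lemma IsSemigroupOf.norm_apply_le (hT : IsSemigroupOf Q T) (t : ℝ≥0) (x : H) :
    ‖T t x‖ ≤ ‖x‖ := by
  simpa using (T t).le_of_opNorm_le (hT.contraction t) x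

lemma IsSemigroupOf.apply_comm (hT : IsSemigroupOf Q T) (s t : ℝ≥0) (x : H) :
    T s (T t x) = T t (T s x) := by
  have h1 := hT.add s t
  rw [add_comm, hT.add t s] at h1
  exact (congrArg (fun A => A x) h1).symm

lemma IsSemigroupOf.pow_eq (hT : IsSemigroupOf Q T) (t : ℝ≥0) (n : ℕ) :
    (T t) ^ n = T (n * t) := by
  induction n with
  | zero => simp [hT.zero, ContinuousLinearMap.one_def]
  | succ k ih =>
    rw [pow_succ, ih, Nat.cast_succ, add_mul, one_mul, hT.add]
    rfl

lemma IsSemigroupOf.isGen_apply (hT : IsSemigroupOf Q T) {u w : H} (h : Q.IsGen u w)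
    (s : ℝ≥0) : Q.IsGen (T s u) (T s w) := by
  refine (hT.generator _ _).1 ?_
  have h1 := ((T s).continuous.tendsto w).comp ((hT.generator u w).2 h)
  refine h1.congr fun t => ?_
  rw [Function.comp_apply, map_smul, map_sub, hT.apply_comm]

variable [CompleteSpace H]

/-- `T s` commutes with L, hence carries the solution of z - hLz = x to that for the datum `T s x`;
uniqueness does the rest. -/
lemma IsSemigroupOf.commute_implicitStep (hT : IsSemigroupOf Q T) {h : ℝ} (h0 : 0 < h)
    (h1 : h ≤ 1) (s : ℝ≥0) : Commute (T s) (Q.implicitStep h) := by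
  refine ContinuousLinearMap.ext fun x => ?_
  refine (Q.implicitStep_eq h0 h1 (hT.isGen_apply (Q.isGen_implicitStep h0 h1 x) s) ?_).symm
  rw [← map_smul, ← map_sub, smul_smul, mul_inv_cancel₀ h0.ne', one_smul, sub_sub_cancel]
  rfl

/-- The exponential formula `T t = lim (1 - (t / n) L)⁻ⁿ`. -/
theorem IsSemigroupOf.tendsto_implicitStep_pow (hT : IsSemigroupOf Q T) {t : ℝ≥0} (ht : 0 < t)
    (x : H) :
    Tendsto (fun n : ℕ => ((Q.implicitStep (t / n)) ^ n) x) atTop (𝓝 (T t x)) := by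
  have ht' : (0 : ℝ) < t := ht
  have hr : Tendsto (fun n : ℕ => (t / n : ℝ)) atTop (𝓝 0) :=
    tendsto_const_div_atTop_nhds_zero_nat _
  have hr' : ∀ᶠ n : ℕ in atTop, 0 < (t / n : ℝ) ∧ (t / n : ℝ) ≤ 1 := by
    filter_upwards [eventually_gt_atTop 0, hr.eventually (gt_mem_nhds one_pos)] with n hn hn'
    exact ⟨div_pos ht' (Nat.cast_pos.2 hn), hn'.le⟩
  refine tendsto_of_tendsto_on_dense (B := T t)
    (A := fun n : ℕ => (Q.implicitStep (t / n)) ^ n) Q.dense_isGen ?_ (hT.norm_apply_le t) ?_ x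
  · filter_upwards [hr'] with n hn
    have h1 : ∀ k : ℕ, ∀ x, ‖((Q.implicitStep (t / n)) ^ k) x‖ ≤ ‖x‖ := by
      intro k
      induction k with
      | zero => simp
      | succ k ih =>
        intro x
        rw [pow_succ, mul_apply_eq_comp]
        exact (ih _).trans (Q.norm_implicitStep_apply_le hn.1 hn.2 x)
    exact h1 n
  · rintro u ⟨w, hu⟩
    have hrt : Tendsto (fun n : ℕ => (t / n : ℝ≥0)) atTop (𝓝[≠] 0) := by
      refine tendsto_nhdsWithin_iff.2 ⟨?_, ?_⟩
      · rw [← NNReal.tendsto_coe]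
        simpa using hr
      · filter_upwards [eventually_gt_atTop 0] with n hn
        exact (div_pos ht (Nat.cast_pos.2 hn)).ne'
    -- With r = t/n, the telescoping bound on the error is t times the distance between the
    -- difference quotient of T at u and (1 - rL)⁻¹w; both tend to w = Lu.
    have h2 := ((hT.generator u w).2 hu).comp hrt
    have h3 := (Q.tendsto_implicitStep hr hr' w)
    have h4 := ((h2.sub h3).norm).const_mul (t : ℝ)
    rw [sub_self, norm_zero, mul_zero] at h4
    rw [tendsto_iff_norm_sub_tendsto_zero]
    refine squeeze_zero' (Eventually.of_forall fun _ => norm_nonneg _) ?_ h4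
    filter_upwards [hr', eventually_gt_atTop 0] with n hn hn0
    have hn0' : (n : ℝ) ≠ 0 := (Nat.cast_pos.2 hn0).ne'
    have h5 : T t = (T (t / n)) ^ n := by
      rw [hT.pow_eq]
      congr 1
      rw [mul_div_cancel₀]
      exact (Nat.cast_pos.2 hn0).ne'
    rw [norm_sub_rev, h5]
    refine (norm_pow_sub_pow_apply_le (hT.norm_apply_le _)
      (Q.norm_implicitStep_apply_le hn.1 hn.2) (hT.commute_implicitStep hn.1 hn.2 _) u n).trans
      (le_of_eq ?_)
    rw [Function.comp_apply, ← Q.implicitStep_sub hn.1 hn.2 hu, NNReal.coe_div,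
      NNReal.coe_natCast, ← smul_sub, sub_sub_sub_cancel_right, norm_smul,
      Real.norm_of_nonneg (inv_nonneg.2 hn.1.le), inv_div, ← mul_assoc, mul_div_cancel₀ _ ht'.ne']

end Semigroups

/-! ### Measurability of the semigroup fields -/

section MeasurableSemigroups

variable {Z : Type*} [MeasurableSpace Z] {ν : Measure Z} {H : Z → Type*}
  [∀ ζ, NormedAddCommGroup (H ζ)] [∀ ζ, InnerProductSpace ℝ (H ζ)]

/-- A field of operators that maps measurable vector fields to measurable vector fields. -/
def FieldSpace.Preserves (S : FieldSpace ν H) (B : ∀ ζ, H ζ →L[ℝ] H ζ) : Prop :=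
  ∀ u ∈ S.carrier, (fun ζ => B ζ (u ζ)) ∈ S.carrier

variable {S : FieldSpace ν H} {A B : ∀ ζ, H ζ →L[ℝ] H ζ}

lemma FieldSpace.Preserves.mul (hA : S.Preserves A) (hB : S.Preserves B) :
    S.Preserves (fun ζ => A ζ * B ζ) := fun u hu => hA _ (hB u hu)

lemma FieldSpace.Preserves.one : S.Preserves (fun _ => 1) := fun _ hu => hu

lemma FieldSpace.Preserves.sub (hA : S.Preserves A) (hB : S.Preserves B) :
    S.Preserves (fun ζ => A ζ - B ζ) := fun u hu => S.carrier.sub_mem (hA u hu) (hB u hu)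

lemma FieldSpace.Preserves.smul (hA : S.Preserves A) (c : ℝ) :
    S.Preserves (fun ζ => c • A ζ) := fun u hu => S.carrier.smul_mem c (hA u hu)

lemma FieldSpace.Preserves.pow (hA : S.Preserves A) (n : ℕ) :
    S.Preserves (fun ζ => A ζ ^ n) := by
  induction n with
  | zero => simpa using FieldSpace.Preserves.one
  | succ k ih => simpa only [pow_succ] using ih.mul hA

lemma FieldSpace.Preserves.sum {A : ℕ → ∀ ζ, H ζ →L[ℝ] H ζ} (hA : ∀ k, S.Preserves (A k))
    (n : ℕ) : S.Preserves (fun ζ => ∑ k ∈ Finset.range n, A k ζ) := by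
  intro u hu
  have h := S.carrier.sum_mem (t := Finset.range n) fun k _ => hA k u hu
  convert h using 1
  funext ζ
  simp

lemma FieldSpace.Preserves.of_tendsto {A : ℕ → ∀ ζ, H ζ →L[ℝ] H ζ}
    (hA : ∀ k, S.Preserves (A k))
    (h : ∀ ζ x, Tendsto (fun n => A n ζ x) atTop (𝓝 (B ζ x))) : S.Preserves B :=
  fun u hu => S.mem_of_tendsto (fun n => hA n u hu) (Eventually.of_forall fun ζ => h ζ _)

variable [∀ ζ, CompleteSpace (H ζ)] {Q : ∀ ζ, ClosedForm (H ζ)}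

/-- ⟨w, J*u⟩ in the form domain equals ⟨Jw, u⟩, which is measurable; so J*u is a measurable field of
the form domains, and J maps those into `S`. -/
lemma IsFormField.preserves_res (hQ : IsFormField S Q) :
    S.Preserves (fun ζ => (Q ζ).res) := by
  obtain ⟨SQ, hSQ⟩ := hQ
  intro u hu
  refine hSQ (fun ζ => (Q ζ).inclL.adjoint (u ζ)) (SQ.mem_of_inner _ fun w hw => ?_)
  simp only [ContinuousLinearMap.adjoint_inner_right]
  exact S.inner_meas (hSQ w hw) hu

lemma IsFormField.preserves_implicitStep (hQ : IsFormField S Q) {h : ℝ} (h0 : 0 < h)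
    (h1 : h ≤ 1) : S.Preserves (fun ζ => (Q ζ).implicitStep h) := by
  refine FieldSpace.Preserves.mul (A := fun ζ => ∑' k : ℕ, ((1 - h) • (1 - (Q ζ).res)) ^ k) ?_
    hQ.preserves_res
  refine FieldSpace.Preserves.of_tendsto
    (A := fun n ζ => ∑ k ∈ Finset.range n, ((1 - h) • (1 - (Q ζ).res)) ^ k)
    (FieldSpace.Preserves.sum fun k =>
      ((FieldSpace.Preserves.one.sub hQ.preserves_res).smul _).pow k) fun ζ x => ?_
  have h2 := (summable_geometric_of_norm_lt_one
    ((Q ζ).norm_smul_one_sub_res_lt h0 h1)).hasSum.tendsto_sum_nat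
  exact ((ContinuousLinearMap.apply ℝ (H ζ) x).continuous.tendsto _).comp h2

theorem IsFormField.isOpField_semigroup (hQ : IsFormField S Q)
    {T : ∀ ζ, ℝ≥0 → H ζ →L[ℝ] H ζ} (hT : ∀ ζ, IsSemigroupOf (Q ζ) (T ζ)) (t : ℝ≥0) :
    IsOpField S S (fun ζ => T ζ t) where
  meas := by
    rcases eq_or_ne t 0 with rfl | ht
    · intro u hu
      simp only [(hT _).zero]
      exact hu
    · have ht0 : 0 < t := pos_iff_ne_zero.2 ht
      -- Starting the sequence at N > t keeps every step size t/(n + N) in (0, 1], where the power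
      -- series is controlled.
      obtain ⟨N, hN⟩ := exists_nat_gt (t : ℝ)
      refine FieldSpace.Preserves.of_tendsto (B := fun ζ => T ζ t)
        (A := fun n ζ => ((Q ζ).implicitStep (t / ((n + N : ℕ) : ℝ))) ^ (n + N))
        (fun n => ?_) fun ζ x => ?_
      · have h1 : (t : ℝ) < ((n + N : ℕ) : ℝ) := by
          push_cast
          linarith [(Nat.cast_nonneg n : (0 : ℝ) ≤ n)]
        have h2 : (0 : ℝ) < t := ht0
        exact (hQ.preserves_implicitStep (div_pos h2 (h2.trans h1))
          ((div_le_one (h2.trans h1)).2 h1.le)).pow _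
      · exact ((hT ζ).tendsto_implicitStep_pow ht0 x).comp (tendsto_add_atTop_nat N)
  essBdd := ⟨1, Eventually.of_forall fun ζ => (hT ζ).contraction t⟩

end MeasurableSemigroups

/-! ### The positive cone of L² -/

section LpTwo

variable {X : Type*} [MeasurableSpace X] {m : Measure X}

lemma eLpNorm_two_sq (f : X → ℝ) (m : Measure X) :
    eLpNorm f 2 m ^ 2 = ∫⁻ x, ‖f x‖ₑ ^ 2 ∂m := by
  have h := eLpNorm_nnreal_pow_eq_lintegral (μ := m) (f := f) (p := 2) two_ne_zero
  simpa using h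

/-- The cone of non-negative functions is the closed convex cone generated by the indicators of a
measure-dense family. -/
lemma nonneg_mem_of_measureDense {C : ℕ → Set X} (hC : m.MeasureDense (Set.range C))
    {P : Set (Lp ℝ 2 m)} (hP : IsClosed P) (hadd : ∀ f ∈ P, ∀ g ∈ P, f + g ∈ P)
    (hsmul : ∀ c : ℝ, 0 ≤ c → ∀ f ∈ P, c • f ∈ P)
    (hmem : ∀ k (hk : m (C k) ≠ ∞), indicatorConstLp 2 (hC.measurable _ ⟨k, rfl⟩) hk (1 : ℝ) ∈ P)
    {f : Lp ℝ 2 m} (hf : 0 ≤ f) : f ∈ P := by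
  have hind : ∀ (s : Set X) (hs : MeasurableSet s) (hμs : m s ≠ ∞),
      indicatorConstLp 2 hs hμs (1 : ℝ) ∈ P := by
    intro s hs hμs
    have : Fact ((2 : ℝ≥0∞) ≠ ∞) := ⟨by simp⟩
    refine closure_minimal ?_ hP (hC.indicatorConstLp_subset_closure 2 (1 : ℝ) ⟨s, hs, hμs, rfl⟩)
    rintro _ ⟨_, ⟨k, rfl⟩, hk, rfl⟩
    exact hmem k hk
  have h0 : (0 : Lp ℝ 2 m) ∈ P := by
    simpa using hsmul 0 le_rfl _ (hind ∅ MeasurableSet.empty (by simp))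
  have hsimple : ∀ (s : SimpleFunc X ℝ≥0) (hs : MemLp (fun x => (s x : ℝ)) 2 m),
      hs.toLp (fun x => (s x : ℝ)) ∈ P := by
    intro s
    induction s using SimpleFunc.induction with
    | const c hs =>
      rename_i A
      intro h
      -- For c = 0 the set `A` may have infinite measure, and its indicator need not be in L².
      rcases eq_or_ne c 0 with rfl | hc
      · convert h0 using 1
        rw [Lp.ext_iff]
        refine h.coeFn_toLp.trans (EventuallyEq.trans ?_ (Lp.coeFn_zero ℝ 2 m).symm)
        refine Eventually.of_forall fun x => ?_
        simp
      · have he : (fun x => ((SimpleFunc.piecewise A hs (SimpleFunc.const X c)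
            (SimpleFunc.const X 0)) x : ℝ)) = A.indicator fun _ => (c : ℝ) := by
          funext x
          by_cases hx : x ∈ A <;> simp [hx]
        have hA : m A ≠ ∞ := by
          rw [he, memLp_indicator_iff_restrict hs, memLp_const_iff two_ne_zero (by simp)] at h
          have hc' : (c : ℝ) ≠ 0 := by exact_mod_cast hc
          exact (by simpa [hc'] using h : m A < ∞).ne
        convert hsmul c c.2 _ (hind A hs hA) using 1
        rw [Lp.ext_iff]
        filter_upwards [h.coeFn_toLp, Lp.coeFn_smul (c : ℝ) (indicatorConstLp 2 hs hA (1 : ℝ)),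
          indicatorConstLp_coeFn (p := 2) (hs := hs) (hμs := hA) (c := (1 : ℝ))] with x h1 h2 h3
        refine h1.trans (Eq.trans ?_ h2.symm)
        rw [Pi.smul_apply, h3, congrFun he x]
        by_cases hx : x ∈ A <;> simp [hx]
    | add hd ihf ihg =>
      rename_i f g
      intro h
      have hm : ∀ s : SimpleFunc X ℝ≥0, AEStronglyMeasurable (fun x => (s x : ℝ)) m := fun s =>
        s.measurable.coe_nnreal_real.aestronglyMeasurable
      have hf : MemLp (fun x => (f x : ℝ)) 2 m := by
        refine h.mono (hm f) (Eventually.of_forall fun x => ?_)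
        simpa using (le_add_of_nonneg_right (g x).2).trans (le_abs_self ((f x : ℝ) + g x))
      have hg : MemLp (fun x => (g x : ℝ)) 2 m := by
        refine h.mono (hm g) (Eventually.of_forall fun x => ?_)
        simpa using (le_add_of_nonneg_left (f x).2).trans (le_abs_self ((f x : ℝ) + g x))
      convert hadd _ (ihf hf) _ (ihg hg) using 1
      rw [← MemLp.toLp_add hf hg]
      congr 1
  have hdense := Lp.simpleFunc.denseRange_coeSimpleFuncNonnegToLpNonneg 2 m ℝ (by simp)
    ⟨f, hf⟩
  have hcl : IsClosed {g : {g : Lp ℝ 2 m // 0 ≤ g} | (g : Lp ℝ 2 m) ∈ P} :=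
    hP.preimage continuous_subtype_val
  refine closure_minimal ?_ hcl hdense
  rintro _ ⟨⟨g, hg⟩, rfl⟩
  -- A pointwise non-negative representative can be read as an ℝ≥0-valued simple function, the form
  -- required by `hsimple`.
  obtain ⟨g', hg'0, hg'⟩ := Lp.simpleFunc.exists_simpleFunc_nonneg_ae_eq hg
  have he : (fun x => ((g'.map Real.toNNReal) x : ℝ)) = g' := by
    funext x
    simpa using hg'0 x
  have hmL : MemLp (fun x => ((g'.map Real.toNNReal) x : ℝ)) 2 m := by
    rw [he]
    exact (memLp_congr_ae hg').1 (Lp.memLp (g : Lp ℝ 2 m))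
  have h2 : (g : Lp ℝ 2 m) = hmL.toLp _ := by
    rw [Lp.ext_iff]
    refine EventuallyEq.trans ?_ hmL.coeFn_toLp.symm
    rw [he]
    exact hg'
  change (g : Lp ℝ 2 m) ∈ P
  rw [h2]
  exact hsimple _ hmL

/-- Functions orthogonal to the indicators of a measure-dense family vanish. -/
lemma eq_zero_of_inner_indicator_eq_zero {C : ℕ → Set X} (hC : m.MeasureDense (Set.range C))
    {u : Lp ℝ 2 m} (h : ∀ k (hk : m (C k) ≠ ∞),
      ⟪indicatorConstLp 2 (hC.measurable _ ⟨k, rfl⟩) hk (1 : ℝ), u⟫_ℝ = 0) : u = 0 := by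
  -- The orthogonal complement of `u` is a closed convex cone; containing the indicators, it
  -- contains all non-negative functions.
  have h1 : ∀ f : Lp ℝ 2 m, 0 ≤ f → ⟪f, u⟫_ℝ = 0 := fun f hf =>
    nonneg_mem_of_measureDense hC (P := {f | ⟪f, u⟫_ℝ = 0})
      (isClosed_eq (by fun_prop) continuous_const)
      (fun f hf g hg => by
        simp only [Set.mem_ofPred_eq] at hf hg ⊢
        rw [inner_add_left, hf, hg, add_zero])
      (fun c _ f hf => by
        simp only [Set.mem_ofPred_eq] at hf ⊢
        rw [real_inner_smul_left, hf, mul_zero]) h hf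
  rw [← inner_self_eq_zero (𝕜 := ℝ)]
  nth_rewrite 1 [← posPart_sub_negPart u]
  rw [inner_sub_left, h1 _ (posPart_nonneg u), h1 _ (negPart_nonneg u), sub_zero]

end LpTwo

/-! ### Pseudo-disintegrations and diagonal fields -/

section Disintegrations

lemma diag_of_memLp {X Z : Type*} [MeasurableSpace X] {μf : Z → Measure X} {f : X → ℝ} {ζ : Z}
    (h : MemLp f 2 (μf ζ)) : diag μf f ζ = h.toLp f :=
  dif_pos h

variable {X Z : Type*} [MeasurableSpace X] [MeasurableSpace Z] {μ : Measure X} {ν : Measure Z}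
  {μf : Z → Measure X}

lemma IsPseudoDisintegration.lintegral (hd : IsPseudoDisintegration μ ν μf) {f : X → ℝ≥0∞}
    (hf : Measurable f) :
    AEMeasurable (fun ζ => ∫⁻ x, f x ∂μf ζ) ν ∧ ∫⁻ x, f x ∂μ = ∫⁻ ζ, ∫⁻ x, f x ∂μf ζ ∂ν := by
  refine Measurable.ennreal_induction (motive := fun f =>
    AEMeasurable (fun ζ => ∫⁻ x, f x ∂μf ζ) ν ∧ ∫⁻ x, f x ∂μ = ∫⁻ ζ, ∫⁻ x, f x ∂μf ζ ∂ν)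
    (fun c s hs => ?_) (fun f g _ hf hg ihf ihg => ?_) (fun f hf hmono ih => ?_) hf
  · have h := hd.meas s hs
    simp only [lintegral_indicator_const hs]
    refine ⟨h.const_mul c, ?_⟩
    rw [lintegral_const_mul'' c h, hd.eq_lintegral s hs]
  · simp only [Pi.add_apply, lintegral_add_left hf]
    refine ⟨ihf.1.add ihg.1, ?_⟩
    rw [lintegral_add_left' ihf.1, ihf.2, ihg.2]
  · simp only [lintegral_iSup hf hmono]
    refine ⟨AEMeasurable.iSup fun n => (ih n).1, ?_⟩
    rw [lintegral_iSup' (fun n => (ih n).1)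
      (Eventually.of_forall fun ζ i j hij => lintegral_mono (hmono hij))]
    exact iSup_congr fun n => (ih n).2

lemma IsPseudoDisintegration.null_iff (hd : IsPseudoDisintegration μ ν μf) {N : Set X}
    (hN : MeasurableSet N) : μ N = 0 ↔ ∀ᵐ ζ ∂ν, μf ζ N = 0 := by
  rw [hd.eq_lintegral N hN, lintegral_eq_zero_iff' (hd.meas N hN)]
  rfl

lemma IsPseudoDisintegration.ae_null (hd : IsPseudoDisintegration μ ν μf) {N : Set X}
    (hN : μ N = 0) : ∀ᵐ ζ ∂ν, μf ζ N = 0 := by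
  have h := (hd.null_iff (measurableSet_toMeasurable μ N)).1 (by rwa [measure_toMeasurable])
  filter_upwards [h] with ζ hζ
  exact measure_mono_null (subset_toMeasurable μ N) hζ

lemma IsPseudoDisintegration.ae_ae (hd : IsPseudoDisintegration μ ν μf) {p : X → Prop}
    (h : ∀ᵐ x ∂μ, p x) : ∀ᵐ ζ ∂ν, ∀ᵐ x ∂μf ζ, p x := hd.ae_null h

lemma IsPseudoDisintegration.ae_ne_top (hd : IsPseudoDisintegration μ ν μf) {A : Set X}
    (hA : MeasurableSet A) (h : μ A ≠ ∞) : ∀ᵐ ζ ∂ν, μf ζ A ≠ ∞ := by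
  rw [hd.eq_lintegral A hA] at h
  filter_upwards [ae_lt_top' (hd.meas A hA) h] with ζ hζ
  exact hζ.ne

lemma IsPseudoDisintegration.eLpNorm_sq (hd : IsPseudoDisintegration μ ν μf) {f : X → ℝ}
    (hf : AEStronglyMeasurable f μ) :
    AEMeasurable (fun ζ => eLpNorm f 2 (μf ζ) ^ 2) ν ∧
      eLpNorm f 2 μ ^ 2 = ∫⁻ ζ, eLpNorm f 2 (μf ζ) ^ 2 ∂ν := by
  obtain ⟨g, hg, hfg⟩ := hf
  have h1 : ∀ᵐ ζ ∂ν, f =ᵐ[μf ζ] g := hd.ae_ae hfg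
  have h2 : (fun ζ => eLpNorm f 2 (μf ζ) ^ 2) =ᵐ[ν] fun ζ => ∫⁻ x, ‖g x‖ₑ ^ 2 ∂μf ζ := by
    filter_upwards [h1] with ζ hζ
    rw [eLpNorm_congr_ae hζ, eLpNorm_two_sq]
  obtain ⟨h3, h4⟩ := hd.lintegral (hg.measurable.enorm.pow_const 2)
  refine ⟨h3.congr h2.symm, ?_⟩
  rw [lintegral_congr_ae h2, ← h4, eLpNorm_congr_ae hfg, eLpNorm_two_sq]

lemma IsPseudoDisintegration.ae_memLp (hd : IsPseudoDisintegration μ ν μf) {f : X → ℝ}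
    (hf : MemLp f 2 μ) : ∀ᵐ ζ ∂ν, MemLp f 2 (μf ζ) := by
  obtain ⟨h1, h2⟩ := hd.eLpNorm_sq hf.1
  have h3 : ∫⁻ ζ, eLpNorm f 2 (μf ζ) ^ 2 ∂ν ≠ ∞ := by
    rw [← h2]
    exact ENNReal.pow_ne_top hf.2.ne
  filter_upwards [ae_lt_top' h1 h3, hd.ae_ae hf.1.ae_eq_mk] with ζ h4 h5
  refine ⟨⟨_, hf.1.stronglyMeasurable_mk, h5⟩, ?_⟩
  by_contra hn
  rw [not_lt, top_le_iff] at hn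
  simp [hn] at h4

lemma IsPseudoDisintegration.enorm_diag (hd : IsPseudoDisintegration μ ν μf) {f : X → ℝ}
    (hf : MemLp f 2 μ) : ∀ᵐ ζ ∂ν, ‖diag μf f ζ‖ₑ = eLpNorm f 2 (μf ζ) := by
  filter_upwards [hd.ae_memLp hf] with ζ hζ
  rw [diag_of_memLp hζ, Lp.enorm_toLp]

lemma IsPseudoDisintegration.lintegral_enorm_diag_sq (hd : IsPseudoDisintegration μ ν μf)
    {f : X → ℝ} (hf : MemLp f 2 μ) :
    AEMeasurable (fun ζ => ‖diag μf f ζ‖ₑ ^ 2) ν ∧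
      ∫⁻ ζ, ‖diag μf f ζ‖ₑ ^ 2 ∂ν = eLpNorm f 2 μ ^ 2 := by
  obtain ⟨h1, h2⟩ := hd.eLpNorm_sq hf.1
  have h3 : (fun ζ => ‖diag μf f ζ‖ₑ ^ 2) =ᵐ[ν] fun ζ => eLpNorm f 2 (μf ζ) ^ 2 := by
    filter_upwards [hd.enorm_diag hf] with ζ hζ
    rw [hζ]
  exact ⟨h1.congr h3.symm, by rw [lintegral_congr_ae h3, h2]⟩

lemma IsPseudoDisintegration.diag_congr (hd : IsPseudoDisintegration μ ν μf) {f g : X → ℝ}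
    (hf : MemLp f 2 μ) (h : f =ᵐ[μ] g) : ∀ᵐ ζ ∂ν, diag μf f ζ = diag μf g ζ := by
  filter_upwards [hd.ae_memLp hf, hd.ae_ae h] with ζ h1 h2
  have h3 : MemLp g 2 (μf ζ) := (memLp_congr_ae h2).1 h1
  rw [diag_of_memLp h1, diag_of_memLp h3]
  exact (MemLp.toLp_eq_toLp_iff h1 h3).2 h2

lemma IsPseudoDisintegration.diag_add (hd : IsPseudoDisintegration μ ν μf) {f g : X → ℝ}
    (hf : MemLp f 2 μ) (hg : MemLp g 2 μ) :
    ∀ᵐ ζ ∂ν, diag μf (f + g) ζ = diag μf f ζ + diag μf g ζ := by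
  filter_upwards [hd.ae_memLp hf, hd.ae_memLp hg] with ζ h1 h2
  rw [diag_of_memLp h1, diag_of_memLp h2, diag_of_memLp (h1.add h2)]
  rfl

lemma IsPseudoDisintegration.diag_smul (hd : IsPseudoDisintegration μ ν μf) {f : X → ℝ}
    (hf : MemLp f 2 μ) (c : ℝ) :
    ∀ᵐ ζ ∂ν, diag μf (c • f) ζ = c • diag μf f ζ := by
  filter_upwards [hd.ae_memLp hf] with ζ h1
  rw [diag_of_memLp h1, diag_of_memLp (h1.const_smul c)]
  rfl

lemma IsPseudoDisintegration.diag_sub (hd : IsPseudoDisintegration μ ν μf) {f g : X → ℝ}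
    (hf : MemLp f 2 μ) (hg : MemLp g 2 μ) :
    ∀ᵐ ζ ∂ν, diag μf (f - g) ζ = diag μf f ζ - diag μf g ζ := by
  filter_upwards [hd.ae_memLp hf, hd.ae_memLp hg] with ζ h1 h2
  rw [diag_of_memLp h1, diag_of_memLp h2, diag_of_memLp (h1.sub h2)]
  rfl

variable {S : FieldSpace ν (fun ζ => Lp ℝ 2 (μf ζ))} {𝒜 : Submodule ℝ (X → ℝ)}

/-- The diagonal fields of all square-integrable functions are measurable. -/
lemma IsGeneratedBy.diag_mem_of_memLp (hS : IsGeneratedBy μ S 𝒜)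
    (hd : IsPseudoDisintegration μ ν μf) {f : X → ℝ} (hf : MemLp f 2 μ) :
    diag μf f ∈ S.carrier := by
  -- Approximation at a geometric rate makes the squared errors summable, so convergence in mean
  -- becomes convergence in almost every fibre.
  have h1 : ∀ n : ℕ, ∃ g ∈ 𝒜, MemLp g 2 μ ∧ eLpNorm (g - f) 2 μ ^ 2 ≤ (2⁻¹ : ℝ≥0∞) ^ n := by
    intro n
    have hε : ((2⁻¹ : ℝ≥0∞) ^ n) ≠ 0 := pow_ne_zero _ (by simp)
    obtain ⟨_, ⟨g, hg, hg', rfl⟩, hy⟩ := EMetric.mem_closure_iff.1 (hS.dense (hf.toLp f)) _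
      (pos_iff_ne_zero.2 hε)
    refine ⟨g, hg, hg', ?_⟩
    rw [edist_comm, Lp.edist_toLp_toLp] at hy
    have h2 : eLpNorm (g - f) 2 μ ≤ 1 :=
      hy.le.trans (pow_le_one₀ zero_le (by simp))
    calc eLpNorm (g - f) 2 μ ^ 2 = eLpNorm (g - f) 2 μ * eLpNorm (g - f) 2 μ := sq _
      _ ≤ 1 * eLpNorm (g - f) 2 μ := by gcongr
      _ ≤ _ := by rw [one_mul]; exact hy.le
  choose g hg hgm hgf using h1
  refine S.mem_of_tendsto (fun n => hS.diag_mem _ (hg n)) ?_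
  have h2 := fun n => hd.lintegral_enorm_diag_sq ((hgm n).sub hf)
  have h3 : ∫⁻ ζ, ∑' n, ‖diag μf (g n - f) ζ‖ₑ ^ 2 ∂ν ≠ ∞ := by
    rw [lintegral_tsum fun n => (h2 n).1]
    simp only [(h2 _).2]
    refine ne_top_of_le_ne_top ?_ (ENNReal.tsum_le_tsum hgf)
    rw [ENNReal.tsum_geometric]
    simp
  filter_upwards [ae_lt_top' (AEMeasurable.tsum fun n => (h2 n).1) h3,
    ae_all_iff.2 fun n => hd.diag_sub (hgm n) hf] with ζ h4 h5
  have h6 := ENNReal.tendsto_atTop_zero_of_tsum_ne_top h4.ne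
  rw [tendsto_iff_edist_tendsto_0]
  have h7 : Tendsto (fun n => (‖diag μf (g n - f) ζ‖ₑ ^ 2) ^ (1 / 2 : ℝ)) atTop (𝓝 0) := by
    have := (ENNReal.continuous_rpow_const (y := (1 / 2 : ℝ))).tendsto 0
    rw [ENNReal.zero_rpow_of_pos (by norm_num)] at this
    exact this.comp h6
  refine h7.congr fun n => ?_
  rw [h5 n, edist_eq_enorm_sub, ← ENNReal.rpow_natCast, ← ENNReal.rpow_mul]
  norm_num

lemma IsPseudoDisintegration.integrable_norm_diag_sq (hd : IsPseudoDisintegration μ ν μf)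
    (hS : IsGeneratedBy μ S 𝒜) {f : X → ℝ} (hf : MemLp f 2 μ) :
    Integrable (fun ζ => ‖diag μf f ζ‖ ^ 2) ν := by
  refine ⟨((S.norm_meas _ (hS.diag_mem_of_memLp hd hf)).pow_const 2).aestronglyMeasurable, ?_⟩
  have h : ∫⁻ ζ, ‖‖diag μf f ζ‖ ^ 2‖ₑ ∂ν = eLpNorm f 2 μ ^ 2 := by
    rw [← (hd.lintegral_enorm_diag_sq hf).2]
    refine lintegral_congr fun ζ => ?_
    rw [enorm_pow, enorm_norm]
  rw [HasFiniteIntegral, h]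
  exact ENNReal.pow_lt_top hf.2

/-- The diagonal field of a square-integrable function, as a square-integrable field. -/
noncomputable def diagField (hd : IsPseudoDisintegration μ ν μf) (hS : IsGeneratedBy μ S 𝒜)
    {f : X → ℝ} (hf : MemLp f 2 μ) : SqInt S :=
  SqInt.of (diag μf f) (hS.diag_mem_of_memLp hd hf) (hd.integrable_norm_diag_sq hS hf)

lemma diagField_apply (hd : IsPseudoDisintegration μ ν μf) (hS : IsGeneratedBy μ S 𝒜)
    {f : X → ℝ} (hf : MemLp f 2 μ) (ζ : Z) : (diagField hd hS hf) ζ = diag μf f ζ := rfl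

lemma norm_diagField (hd : IsPseudoDisintegration μ ν μf) (hS : IsGeneratedBy μ S 𝒜)
    {f : X → ℝ} (hf : MemLp f 2 μ) : ‖diagField hd hS hf‖ = ‖hf.toLp f‖ := by
  rw [← sq_eq_sq₀ (norm_nonneg _) (norm_nonneg _), SqInt.norm_sq,
    integral_eq_lintegral_of_nonneg_ae (Eventually.of_forall fun _ => sq_nonneg _)
      (diagField hd hS hf).2.2.1, Lp.norm_toLp, ← ENNReal.toReal_pow,
    ← (hd.lintegral_enorm_diag_sq hf).2]
  congr 1
  refine lintegral_congr fun ζ => ?_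
  rw [diagField_apply, ENNReal.ofReal_pow (norm_nonneg _), ofReal_norm]

/-- A countable family of measurable sets of finite measure which is measure-dense for almost all
measures of a pseudo-disintegration. -/
lemma IsPseudoDisintegration.exists_measureDense (hd : IsPseudoDisintegration μ ν μf)
    (hμ : IsSigmaFiniteStandard μ) :
    ∃ C : ℕ → Set X, (∀ k, MeasurableSet (C k)) ∧ (∀ k, μ (C k) ≠ ∞) ∧
      ∀ᵐ ζ ∂ν, (μf ζ).MeasureDense (Set.range C) := by
  obtain ⟨hσ, X₀, hX₀, hX₀', hB⟩ := hμ
  let 𝒢 := generateSetAlgebra (MeasurableSpace.countableGeneratingSet X₀)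
  have h𝒢c : 𝒢.Countable :=
    countable_generateSetAlgebra MeasurableSpace.countable_countableGeneratingSet
  have hgen : (inferInstance : MeasurableSpace X₀) = MeasurableSpace.generateFrom 𝒢 := by
    rw [generateFrom_generateSetAlgebra_eq, MeasurableSpace.generateFrom_countableGeneratingSet]
  have h𝒢m : ∀ B ∈ 𝒢, MeasurableSet B := fun B hB' => by
    have h := MeasurableSpace.measurableSet_generateFrom hB'
    rwa [← hgen] at h
  let A := spanningSets μ
  -- A countable algebra generating the σ-algebra of X₀, cut by the spanning sets of μ: all members
  -- have finite μ-measure.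
  let F : Set (Set X) := (fun q : Set X₀ × ℕ => (Subtype.val '' q.1) ∩ A q.2) ''
    (𝒢 ×ˢ Set.univ)
  have hF : F.Countable := (h𝒢c.prod Set.countable_univ).image _
  have hFm : ∀ s ∈ F, MeasurableSet s ∧ μ s ≠ ∞ := by
    rintro _ ⟨⟨B, n⟩, ⟨hB', -⟩, rfl⟩
    exact ⟨(hX₀.subtype_image (h𝒢m B hB')).inter (measurableSet_spanningSets μ n),
      measure_ne_top_of_subset Set.inter_subset_right (measure_spanningSets_lt_top μ n).ne⟩
  have hFn : F.Nonempty :=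
    ⟨_, ⟨⟨∅, 0⟩, ⟨isSetAlgebra_generateSetAlgebra.empty_mem, trivial⟩, rfl⟩⟩
  obtain ⟨C, hC⟩ := hF.exists_eq_range hFn
  refine ⟨C, fun k => (hFm _ (hC ▸ ⟨k, rfl⟩)).1, fun k => (hFm _ (hC ▸ ⟨k, rfl⟩)).2, ?_⟩
  rw [← hC]
  filter_upwards [hd.ae_null hX₀', ae_all_iff.2 fun n => hd.ae_ne_top
    (measurableSet_spanningSets μ n) (measure_spanningSets_lt_top μ n).ne] with ζ h1 h2
  refine ⟨fun s hs => (hFm s hs).1, fun s hs hμs ε hε => ?_⟩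
  have hε2 : 0 < ENNReal.ofReal (ε / 2) := ENNReal.ofReal_pos.2 (by positivity)
  -- Half of ε pays for the part of `s` outside a spanning set, the other half for the approximation
  -- inside it, where `μf ζ` is finite.
  have h3 : Tendsto (fun n => μf ζ (s \ A n)) atTop (𝓝 0) := by
    have h4 : (⋂ n, s \ A n) = ∅ := by
      rw [← Set.sdiff_iUnion, iUnion_spanningSets, Set.sdiff_univ]
    rw [← measure_empty (μ := μf ζ), ← h4]
    refine tendsto_measure_iInter_atTop
      (fun n => (hs.diff (measurableSet_spanningSets μ n)).nullMeasurableSet)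
      (fun i j hij => Set.sdiff_subset_sdiff_right (monotone_spanningSets μ hij)) ⟨0, ?_⟩
    exact measure_ne_top_of_subset Set.sdiff_subset hμs
  obtain ⟨n, hn⟩ := (h3.eventually (gt_mem_nhds hε2)).exists
  have hemb : MeasurableEmbedding (Subtype.val : X₀ → X) := MeasurableEmbedding.subtype_coe hX₀
  let m' : Measure X₀ := ((μf ζ).restrict (A n)).comap Subtype.val
  have hm' : ∀ t, m' t = (μf ζ).restrict (A n) (Subtype.val '' t) := hemb.comap_apply _
  have : IsFiniteMeasure m' := by
    refine ⟨?_⟩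
    rw [hm']
    refine (measure_mono (Set.subset_univ _)).trans_lt ?_
    rw [Measure.restrict_apply_univ]
    exact (h2 n).lt_top
  obtain ⟨B, hB', hlt⟩ := (Measure.MeasureDense.of_generateFrom_isSetAlgebra_finite m'
    (isSetAlgebra_generateSetAlgebra) hgen).approx (Subtype.val ⁻¹' s)
    (measurable_subtype_coe hs) (measure_ne_top _ _) (ε / 2) (by positivity)
  refine ⟨_, ⟨⟨B, n⟩, ⟨hB', trivial⟩, rfl⟩, ?_⟩
  rw [hm', Measure.restrict_apply' (measurableSet_spanningSets μ n)] at hlt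
  have hsub : symmDiff s ((Subtype.val '' B) ∩ A n) ⊆ (s \ A n) ∪ X₀ᶜ ∪
      (Subtype.val '' (symmDiff (Subtype.val ⁻¹' s) B) ∩ A n) := by
    intro x hx
    by_cases hxA : x ∈ A n
    · by_cases hx0 : x ∈ X₀
      · refine Or.inr ⟨⟨⟨x, hx0⟩, ?_, rfl⟩, hxA⟩
        simpa [Set.mem_symmDiff, hxA, hx0] using hx
      · exact Or.inl (Or.inr hx0)
    · refine Or.inl (Or.inl ⟨?_, hxA⟩)
      simpa [Set.mem_symmDiff, hxA] using hx
  calc μf ζ (symmDiff s ((Subtype.val '' B) ∩ A n))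
      ≤ μf ζ (s \ A n) + μf ζ X₀ᶜ
        + μf ζ (Subtype.val '' (symmDiff (Subtype.val ⁻¹' s) B) ∩ A n) :=
        (measure_mono hsub).trans ((measure_union_le _ _).trans
          (add_le_add_left (measure_union_le _ _) _))
    _ < ENNReal.ofReal (ε / 2) + ENNReal.ofReal (ε / 2) := by
        rw [h1, add_zero]
        exact ENNReal.add_lt_add hn hlt
    _ = ENNReal.ofReal ε := by
        rw [← ENNReal.ofReal_add (by positivity) (by positivity), add_halves]

end Disintegrations

/-! ### Indicator functions in L² -/

section Indicators

variable {X : Type*} [MeasurableSpace X] {μ : Measure X}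

lemma memLp_indicator_one {A : Set X} (hA : NullMeasurableSet A μ) (h : μ A ≠ ∞) :
    MemLp (A.indicator fun _ => (1 : ℝ)) 2 μ := by
  have h1 : MemLp ((toMeasurable μ A).indicator fun _ => (1 : ℝ)) 2 μ :=
    memLp_indicator_const 2 (measurableSet_toMeasurable μ A) 1 (Or.inr (by simpa using h))
  exact (memLp_congr_ae (indicator_ae_eq_of_ae_eq_set hA.toMeasurable_ae_eq)).1 h1

lemma smul_nonneg_Lp {m : Measure X} {c : ℝ} (hc : 0 ≤ c) {f : Lp ℝ 2 m} (hf : 0 ≤ f) :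
    0 ≤ c • f := by
  rw [← Lp.coeFn_nonneg] at hf ⊢
  filter_upwards [hf, Lp.coeFn_smul c f] with x h1 h2
  rw [h2]
  exact mul_nonneg hc h1

lemma diag_indicator {A : Set X} (hA : MeasurableSet A) {Z : Type*} {μf : Z → Measure X} {ζ : Z} (h : μf ζ A ≠ ∞) :
    diag μf (A.indicator fun _ => (1 : ℝ)) ζ = indicatorConstLp 2 hA h 1 :=
  diag_of_memLp (memLp_indicator_const 2 hA 1 (Or.inr h))

end Indicators

/-! ### Order preservation -/

section Order

variable {X Z : Type*} [MeasurableSpace X] [MeasurableSpace Z] {μ : Measure X} {ν : Measure Z}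
  {μf : Z → Measure X} {S : FieldSpace ν (fun ζ => Lp ℝ 2 (μf ζ))} {𝒜 : Submodule ℝ (X → ℝ)}

lemma isNonneg_cls_iff (u : SqInt S) : IsNonneg (cls u) ↔ ∀ᵐ ζ ∂ν, 0 ≤ u ζ := by
  constructor
  · rintro ⟨v, hv, hv0⟩
    filter_upwards [cls_eq_iff.1 hv, hv0] with ζ h1 h2
    rwa [← h1]
  · exact fun h => ⟨u, rfl, h⟩

variable {Y : Type*} [MeasurableSpace Y] {μg : Z → Measure Y}
  {R : FieldSpace ν (fun ζ => Lp ℝ 2 (μg ζ))} {U : ∀ ζ, Lp ℝ 2 (μf ζ) →L[ℝ] Lp ℝ 2 (μg ζ)}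

theorem isOrderPreserving_dint_iff (hμ : IsSigmaFiniteStandard μ)
    (hd : IsPseudoDisintegration μ ν μf) (hS : IsGeneratedBy μ S 𝒜) (hU : IsOpField S R U) :
    (∀ h, IsNonneg h → IsNonneg (dint hU h)) ↔ ∀ᵐ ζ ∂ν, IsOrderPreserving (U ζ) := by
  constructor
  · intro h
    obtain ⟨C, hCm, hCf, hC⟩ := hd.exists_measureDense hμ
    have hmem : ∀ k, MemLp ((C k).indicator fun _ => (1 : ℝ)) 2 μ := fun k =>
      memLp_indicator_one (hCm k).nullMeasurableSet (hCf k)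
    -- Each `C k` gives one non-negative field to test; countability puts all the exceptional sets
    -- into a single null set.
    have h1 : ∀ k, ∀ᵐ ζ ∂ν, 0 ≤ U ζ (diag μf ((C k).indicator fun _ => (1 : ℝ)) ζ) := by
      intro k
      have h2 : IsNonneg (cls (diagField hd hS (hmem k))) := by
        rw [isNonneg_cls_iff]
        filter_upwards [hd.ae_ne_top (hCm k) (hCf k)] with ζ hζ
        rw [diagField_apply, diag_indicator (hCm k) hζ, ← Lp.coeFn_nonneg]
        filter_upwards [indicatorConstLp_coeFn (p := 2) (hs := hCm k) (hμs := hζ)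
          (c := (1 : ℝ))] with x hx
        rw [hx]
        exact Set.indicator_nonneg (fun _ _ => zero_le_one) x
      have h3 := h _ h2
      rw [dint_cls, isNonneg_cls_iff] at h3
      exact h3
    filter_upwards [hC, ae_all_iff.2 h1] with ζ hζ h2 f hf
    refine nonneg_mem_of_measureDense hζ (P := {f | 0 ≤ U ζ f})
      (isClosed_le continuous_const (U ζ).continuous) (fun f hf g hg => ?_)
      (fun c hc f hf => ?_) (fun k hk => ?_) hf
    · simp only [Set.mem_ofPred_eq, map_add] at hf hg ⊢
      exact add_nonneg hf hg
    · simp only [Set.mem_ofPred_eq, map_smul] at hf ⊢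
      exact smul_nonneg_Lp hc hf
    · have h3 := h2 k
      rwa [diag_indicator (hCm k) hk] at h3
  · intro h x hx
    obtain ⟨u, rfl, hu⟩ := hx
    rw [dint_cls, isNonneg_cls_iff]
    filter_upwards [h, hu] with ζ h1 h2
    exact h1 _ h2

end Order

/-! ### The canonical identification with the direct integral -/

section Canonical

variable {X Z : Type*} [MeasurableSpace X] [MeasurableSpace Z] {μ : Measure X} {ν : Measure Z}
  {μf : Z → Measure X} {S : FieldSpace ν (fun ζ => Lp ℝ 2 (μf ζ))} {𝒜 : Submodule ℝ (X → ℝ)}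

/-- The canonical isometric embedding of `L²(μ)` in the direct integral. -/
noncomputable def diagIsometry (hd : IsPseudoDisintegration μ ν μf) (hS : IsGeneratedBy μ S 𝒜) :
    Lp ℝ 2 μ →ₗᵢ[ℝ] DirectIntegral S where
  toFun g := cls (diagField hd hS (Lp.memLp g))
  map_add' f g := by
    rw [← SeparationQuotient.mk_add, cls_eq_iff]
    filter_upwards [hd.diag_congr (Lp.memLp (f + g)) (Lp.coeFn_add f g),
      hd.diag_add (Lp.memLp f) (Lp.memLp g)] with ζ h1 h2
    rw [SqInt.add_apply, diagField_apply, diagField_apply, diagField_apply, h1, h2]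
  map_smul' c f := by
    rw [RingHom.id_apply, ← SeparationQuotient.mk_smul, cls_eq_iff]
    filter_upwards [hd.diag_congr (Lp.memLp (c • f)) (Lp.coeFn_smul c f),
      hd.diag_smul (Lp.memLp f) c] with ζ h1 h2
    rw [SqInt.smul_apply, diagField_apply, diagField_apply, h1, h2]
  norm_map' f := by
    change ‖cls (diagField hd hS (Lp.memLp f))‖ = ‖f‖
    rw [norm_cls, norm_diagField, Lp.toLp_coeFn]

lemma diagIsometry_toLp (hd : IsPseudoDisintegration μ ν μf) (hS : IsGeneratedBy μ S 𝒜)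
    {f : X → ℝ} (hf : MemLp f 2 μ) :
    diagIsometry hd hS (hf.toLp f) = cls (diagField hd hS hf) := by
  change cls (diagField hd hS (Lp.memLp (hf.toLp f))) = _
  rw [cls_eq_iff]
  exact hd.diag_congr (Lp.memLp _) hf.coeFn_toLp

/-- On the fibre over ζ one has s = ζ almost everywhere, so the indicator of `s ⁻¹' E` is the
constant value of the indicator of `E` at ζ. -/
lemma ae_diag_indicator_inter {s : X → Z} (hs : ∀ᵐ ζ ∂ν, μf ζ (s ⁻¹' {ζ})ᶜ = 0)
    (E : Set Z) {A : Set X} (hA : ∀ᵐ ζ ∂ν, MemLp (A.indicator fun _ => (1 : ℝ)) 2 (μf ζ)) :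
    ∀ᵐ ζ ∂ν, diag μf ((s ⁻¹' E ∩ A).indicator fun _ => (1 : ℝ)) ζ
      = E.indicator (fun _ => (1 : ℝ)) ζ • diag μf (A.indicator fun _ => (1 : ℝ)) ζ := by
  filter_upwards [hs, hA] with ζ h1 h2
  have h3 : ((s ⁻¹' E ∩ A).indicator fun _ => (1 : ℝ))
      =ᵐ[μf ζ] E.indicator (fun _ => (1 : ℝ)) ζ • (A.indicator fun _ => (1 : ℝ)) := by
    have h4 : ∀ᵐ x ∂μf ζ, s x = ζ := h1
    filter_upwards [h4] with x hx
    by_cases hE : ζ ∈ E <;> by_cases hxA : x ∈ A <;> simp [hx, hE, hxA]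
  have h5 := h2.const_smul (E.indicator (fun _ => (1 : ℝ)) ζ)
  have h6 := (memLp_congr_ae h3).2 h5
  rw [diag_of_memLp h2, diag_of_memLp h6, ← MemLp.toLp_const_smul]
  exact (MemLp.toLp_eq_toLp_iff h6 h5).2 h3

lemma surjective_diagIsometry [SigmaFinite ν] (hμ : IsSigmaFiniteStandard μ)
    (hd : IsPseudoDisintegration μ ν μf) (hS : IsGeneratedBy μ S 𝒜)
    (hsep : IsMeasurablySeparated μ ν μf) : Function.Surjective (diagIsometry hd hS) := by
  obtain ⟨s, hs, hs'⟩ := hsep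
  obtain ⟨C, hCm, hCf, hC⟩ := hd.exists_measureDense hμ
  have hcomplete : CompleteSpace (LinearMap.range (diagIsometry hd hS).toLinearMap) :=
    completeSpace_coe_iff_isComplete.2
      (diagIsometry hd hS).isometry.isUniformInducing.isComplete_range
  rw [← LinearIsometry.coe_toLinearMap, ← LinearMap.range_eq_top,
    ← Submodule.orthogonal_eq_bot_iff, Submodule.eq_bot_iff]
  intro y hy
  obtain ⟨u, rfl⟩ := y.exists_cls
  have hmem : ∀ k, MemLp ((C k).indicator fun _ => (1 : ℝ)) 2 μ := fun k =>
    memLp_indicator_one (hCm k).nullMeasurableSet (hCf k)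
  -- Testing `u` against the images of the indicators of `s ⁻¹' E ∩ C k` makes the integral of this
  -- inner product vanish over every measurable E.
  have h1 : ∀ k, ∀ᵐ ζ ∂ν, ⟪diag μf ((C k).indicator fun _ => (1 : ℝ)) ζ, u ζ⟫_ℝ = 0 := by
    intro k
    have hint : Integrable
        (fun ζ => ⟪diag μf ((C k).indicator fun _ => (1 : ℝ)) ζ, u ζ⟫_ℝ) ν :=
      S.inner_integrable (diagField hd hS (hmem k)).2.1 u.2.1
        (diagField hd hS (hmem k)).2.2 u.2.2
    refine hint.ae_eq_zero_of_forall_setIntegral_eq_zero fun E hE _ => ?_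
    have hEC : MemLp ((s ⁻¹' E ∩ C k).indicator fun _ => (1 : ℝ)) 2 μ :=
      memLp_indicator_one ((hs hE).inter (hCm k).nullMeasurableSet)
        (measure_ne_top_of_subset Set.inter_subset_right (hCf k))
    have h2 : ⟪cls (diagField hd hS hEC), cls u⟫_ℝ = 0 :=
      hy _ ⟨hEC.toLp _, diagIsometry_toLp hd hS hEC⟩
    rw [SeparationQuotient.inner_mk_mk, SqInt.inner_eq] at h2
    rw [← integral_indicator hE, ← h2]
    refine integral_congr_ae ?_
    filter_upwards [ae_diag_indicator_inter hs' E (hd.ae_memLp (hmem k))] with ζ hζ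
    rw [diagField_apply, hζ, real_inner_smul_left]
    by_cases hζE : ζ ∈ E <;> simp [hζE]
  rw [← SeparationQuotient.mk_zero, cls_eq_iff]
  filter_upwards [hC, ae_all_iff.2 h1] with ζ h2 h3
  refine eq_zero_of_inner_indicator_eq_zero h2 fun k hk => ?_
  have h4 := h3 k
  rwa [diag_indicator (hCm k) hk] at h4

/-- The canonical identification of `L²(μ)` with the direct integral. -/
theorem exists_isCanonical [SigmaFinite ν] (hμ : IsSigmaFiniteStandard μ)
    (hd : IsPseudoDisintegration μ ν μf) (hS : IsGeneratedBy μ S 𝒜)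
    (hsep : IsMeasurablySeparated μ ν μf) :
    ∃ ι : Lp ℝ 2 μ ≃ₗᵢ[ℝ] DirectIntegral S, IsCanonical ι :=
  ⟨LinearIsometryEquiv.ofSurjective _ (surjective_diagIsometry hμ hd hS hsep), fun _ hf =>
    ⟨diagField hd hS hf, diagIsometry_toLp hd hS hf, Eventually.of_forall fun _ => rfl⟩⟩

/-- The set where g is negative is μ-null iff it is null for almost every `μf ζ`. -/
lemma IsCanonical.isNonneg_iff (hd : IsPseudoDisintegration μ ν μf)
    {ι : Lp ℝ 2 μ ≃ₗᵢ[ℝ] DirectIntegral S} (hι : IsCanonical ι) (g : Lp ℝ 2 μ) :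
    IsNonneg (ι g) ↔ 0 ≤ g := by
  obtain ⟨u, hu, hu'⟩ := hι g (Lp.memLp g)
  rw [Lp.toLp_coeFn] at hu
  rw [hu, isNonneg_cls_iff, ← Lp.coeFn_nonneg]
  have h1 : ∀ᵐ ζ ∂ν, (0 ≤ u ζ ↔ ∀ᵐ x ∂μf ζ, 0 ≤ g x) := by
    filter_upwards [hu', hd.ae_memLp (Lp.memLp g)] with ζ h2 h3
    rw [h2, diag_of_memLp h3, ← Lp.coeFn_nonneg]
    exact ⟨fun h => by filter_upwards [h, h3.coeFn_toLp] with x h4 h5; rwa [← h5],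
      fun h => by filter_upwards [h, h3.coeFn_toLp] with x h4 h5; rwa [h5]⟩
  rw [eventually_congr h1]
  have hm : MeasurableSet {x | ¬ 0 ≤ g x} :=
    (measurableSet_le measurable_const (Lp.stronglyMeasurable g).measurable).compl
  exact (hd.null_iff hm).symm

end Canonical

/-! ### Transport through the identifications -/

section Pull

variable {E₁ E₂ E₃ F₁ F₂ F₃ : Type*} [NormedAddCommGroup E₁] [InnerProductSpace ℝ E₁]
  [NormedAddCommGroup E₂] [InnerProductSpace ℝ E₂] [NormedAddCommGroup E₃]
  [InnerProductSpace ℝ E₃] [NormedAddCommGroup F₁] [InnerProductSpace ℝ F₁]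
  [NormedAddCommGroup F₂] [InnerProductSpace ℝ F₂] [NormedAddCommGroup F₃]
  [InnerProductSpace ℝ F₃] (ι₁ : E₁ ≃ₗᵢ[ℝ] F₁) (ι₂ : E₂ ≃ₗᵢ[ℝ] F₂) (ι₃ : E₃ ≃ₗᵢ[ℝ] F₃)

lemma pull_apply (B : F₁ →L[ℝ] F₂) (x : E₁) : pull ι₁ ι₂ B x = ι₂.symm (B (ι₁ x)) := rfl

lemma pull_comp (B' : F₂ →L[ℝ] F₃) (B : F₁ →L[ℝ] F₂) :
    (pull ι₂ ι₃ B').comp (pull ι₁ ι₂ B) = pull ι₁ ι₃ (B'.comp B) := by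
  ext x
  simp [pull_apply]

lemma pull_id : pull ι₁ ι₁ (ContinuousLinearMap.id ℝ F₁) = ContinuousLinearMap.id ℝ E₁ := by
  ext x
  simp [pull_apply]

lemma isUnitary_pull_iff (B : F₁ →L[ℝ] F₂) : IsUnitary (pull ι₁ ι₂ B) ↔ IsUnitary B := by
  refine and_congr ⟨fun h x => ?_, fun h x => ?_⟩ ?_
  · simpa [pull_apply] using h (ι₁.symm x)
  · simpa [pull_apply] using h (ι₁ x)
  · have h : (pull ι₁ ι₂ B : E₁ → E₂) = ι₂.symm ∘ B ∘ ι₁ := rfl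
    rw [h, Function.Surjective.of_comp_iff' ι₂.symm.bijective,
      Function.Surjective.of_comp_iff _ ι₁.surjective]

lemma commutes_pull_iff (B : F₁ →L[ℝ] F₂) (A₁ : F₁ →L[ℝ] F₁) (A₂ : F₂ →L[ℝ] F₂) :
    Commutes (pull ι₁ ι₂ B) (pull ι₁ ι₁ A₁) (pull ι₂ ι₂ A₂) ↔ Commutes B A₁ A₂ := by
  refine ⟨fun h x => ?_, fun h x => ?_⟩
  · simpa [pull_apply] using h (ι₁.symm x)
  · simpa [pull_apply] using h (ι₁ x)

lemma isInvertible_pull_iff (B : F₁ →L[ℝ] F₂) :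
    (pull ι₁ ι₂ B).IsInvertible ↔ B.IsInvertible := by
  rw [pull, ContinuousLinearMap.isInvertible_equiv_comp,
    ContinuousLinearMap.isInvertible_comp_equiv]

lemma intertwines_pull_iff (B : F₁ →L[ℝ] F₂) (A₁ : F₁ →L[ℝ] F₁) (A₂ : F₂ →L[ℝ] F₂) :
    Intertwines (pull ι₁ ι₂ B) (pull ι₁ ι₁ A₁) (pull ι₂ ι₂ A₂) ↔ Intertwines B A₁ A₂ :=
  and_congr (isInvertible_pull_iff _ _ _) (commutes_pull_iff _ _ _ _ _)

end Pull

lemma isOrderPreserving_pull_iff {X Y Z : Type*} [MeasurableSpace X] [MeasurableSpace Y]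
    [MeasurableSpace Z] {μ : Measure X} {μ' : Measure Y} {ν : Measure Z} {μf : Z → Measure X}
    {μg : Z → Measure Y} {S : FieldSpace ν (fun ζ => Lp ℝ 2 (μf ζ))}
    {R : FieldSpace ν (fun ζ => Lp ℝ 2 (μg ζ))} (hd : IsPseudoDisintegration μ ν μf)
    (hd' : IsPseudoDisintegration μ' ν μg) {ι₁ : Lp ℝ 2 μ ≃ₗᵢ[ℝ] DirectIntegral S}
    {ι₂ : Lp ℝ 2 μ' ≃ₗᵢ[ℝ] DirectIntegral R} (h₁ : IsCanonical ι₁) (h₂ : IsCanonical ι₂)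
    (B : DirectIntegral S →L[ℝ] DirectIntegral R) :
    IsOrderPreserving (pull ι₁ ι₂ B) ↔ ∀ h, IsNonneg h → IsNonneg (B h) := by
  constructor
  · intro h x hx
    have h1 := h (ι₁.symm x) ((h₁.isNonneg_iff hd _).1 (by simpa using hx))
    rw [← h₂.isNonneg_iff hd'] at h1
    simpa [pull_apply] using h1
  · intro h f hf
    rw [← h₂.isNonneg_iff hd', pull_apply, LinearIsometryEquiv.apply_symm_apply]
    exact h _ ((h₁.isNonneg_iff hd _).2 hf)

end DirInt

open DirInt in
theorem propositionp
    {X₁ X₂ Z : Type*} [MeasurableSpace X₁] [MeasurableSpace X₂] [MeasurableSpace Z]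
    (μ₁ : Measure X₁) (μ₂ : Measure X₂) (ν : Measure Z)
    (hμ₁ : IsSigmaFiniteStandard μ₁) (hμ₂ : IsSigmaFiniteStandard μ₂)
    [SigmaFinite ν] [MeasurableSpace.CountablyGenerated Z]
    (μf₁ : Z → Measure X₁) (μf₂ : Z → Measure X₂)
    (hd₁ : IsPseudoDisintegration μ₁ ν μf₁) (hd₂ : IsPseudoDisintegration μ₂ ν μf₂)
    -- the direct integrals of the `L²`-spaces
    (S₁ : FieldSpace ν (fun ζ => Lp ℝ 2 (μf₁ ζ))) (S₂ : FieldSpace ν (fun ζ => Lp ℝ 2 (μf₂ ζ)))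
    (𝒜₁ : Submodule ℝ (X₁ → ℝ)) (𝒜₂ : Submodule ℝ (X₂ → ℝ))
    (hS₁ : IsGeneratedBy μ₁ S₁ 𝒜₁) (hS₂ : IsGeneratedBy μ₂ S₂ 𝒜₂)
    -- the field of operators
    (U : ∀ ζ, Lp ℝ 2 (μf₁ ζ) →L[ℝ] Lp ℝ 2 (μf₂ ζ)) (hU : IsOpField S₁ S₂ U)
    -- the fields of forms and their semigroups
    (Q₁ : ∀ ζ, ClosedForm (Lp ℝ 2 (μf₁ ζ))) (Q₂ : ∀ ζ, ClosedForm (Lp ℝ 2 (μf₂ ζ)))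
    (hQ₁ : IsFormField S₁ Q₁) (hQ₂ : IsFormField S₂ Q₂)
    (T₁ : ∀ ζ, ℝ≥0 → Lp ℝ 2 (μf₁ ζ) →L[ℝ] Lp ℝ 2 (μf₁ ζ))
    (T₂ : ∀ ζ, ℝ≥0 → Lp ℝ 2 (μf₂ ζ) →L[ℝ] Lp ℝ 2 (μf₂ ζ))
    (hT₁ : ∀ ζ, IsSemigroupOf (Q₁ ζ) (T₁ ζ)) (hT₂ : ∀ ζ, IsSemigroupOf (Q₂ ζ) (T₂ ζ)) :
    -- the semigroups are measurable fields of bounded operators, so that the operators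
    -- `dint (hm₁ t)` and `dint (hm₂ t)` exist
    ∃ (hm₁ : ∀ t, IsOpField S₁ S₁ (fun ζ => T₁ ζ t)) (hm₂ : ∀ t, IsOpField S₂ S₂ (fun ζ => T₂ ζ t)),
      -- statements for the operator between the direct integrals
      ((IsUnitary (dint hU) ↔ ∀ᵐ ζ ∂ν, IsUnitary (U ζ)) ∧
        (IsUnitary (dint hU) →
          ∃ hI : IsOpField S₂ S₁ (fun ζ => (U ζ).inverse),
            (dint hI).comp (dint hU) = ContinuousLinearMap.id ℝ _ ∧
            (dint hU).comp (dint hI) = ContinuousLinearMap.id ℝ _) ∧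
        ((∀ h, IsNonneg h → IsNonneg (dint hU h)) ↔ ∀ᵐ ζ ∂ν, IsOrderPreserving (U ζ)) ∧
        (∀ t, Commutes (dint hU) (dint (hm₁ t)) (dint (hm₂ t)) ↔
          ∀ᵐ ζ ∂ν, Commutes (U ζ) (T₁ ζ t) (T₂ ζ t)) ∧
        ((dint hU).IsInvertible → ∀ t, (Intertwines (dint hU) (dint (hm₁ t)) (dint (hm₂ t)) ↔
          ∀ᵐ ζ ∂ν, Intertwines (U ζ) (T₁ ζ t) (T₂ ζ t))) ∧
        ((∀ t, Commutes (dint hU) (dint (hm₁ t)) (dint (hm₂ t))) ↔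
          ∀ᵐ ζ ∂ν, ∀ t, Commutes (U ζ) (T₁ ζ t) (T₂ ζ t))) ∧
      -- statements for the operator between `L²(μ₁)` and `L²(μ₂)`
      (IsMeasurablySeparated μ₁ ν μf₁ → IsMeasurablySeparated μ₂ ν μf₂ →
        ∃ (ι₁ : Lp ℝ 2 μ₁ ≃ₗᵢ[ℝ] DirectIntegral S₁) (ι₂ : Lp ℝ 2 μ₂ ≃ₗᵢ[ℝ] DirectIntegral S₂),
          IsCanonical ι₁ ∧ IsCanonical ι₂ ∧
          (IsUnitary (pull ι₁ ι₂ (dint hU)) ↔ ∀ᵐ ζ ∂ν, IsUnitary (U ζ)) ∧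
          (IsUnitary (pull ι₁ ι₂ (dint hU)) →
            ∃ hI : IsOpField S₂ S₁ (fun ζ => (U ζ).inverse),
              (pull ι₂ ι₁ (dint hI)).comp (pull ι₁ ι₂ (dint hU)) = ContinuousLinearMap.id ℝ _ ∧
              (pull ι₁ ι₂ (dint hU)).comp (pull ι₂ ι₁ (dint hI)) = ContinuousLinearMap.id ℝ _) ∧
          (IsOrderPreserving (pull ι₁ ι₂ (dint hU)) ↔ ∀ᵐ ζ ∂ν, IsOrderPreserving (U ζ)) ∧
          (∀ t, Commutes (pull ι₁ ι₂ (dint hU)) (pull ι₁ ι₁ (dint (hm₁ t)))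
              (pull ι₂ ι₂ (dint (hm₂ t))) ↔
            ∀ᵐ ζ ∂ν, Commutes (U ζ) (T₁ ζ t) (T₂ ζ t)) ∧
          ((pull ι₁ ι₂ (dint hU)).IsInvertible → ∀ t,
            (Intertwines (pull ι₁ ι₂ (dint hU)) (pull ι₁ ι₁ (dint (hm₁ t)))
              (pull ι₂ ι₂ (dint (hm₂ t))) ↔
            ∀ᵐ ζ ∂ν, Intertwines (U ζ) (T₁ ζ t) (T₂ ζ t))) ∧
          ((∀ t, Commutes (pull ι₁ ι₂ (dint hU)) (pull ι₁ ι₁ (dint (hm₁ t)))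
              (pull ι₂ ι₂ (dint (hm₂ t)))) ↔
            ∀ᵐ ζ ∂ν, ∀ t, Commutes (U ζ) (T₁ ζ t) (T₂ ζ t))) := by
  have hm₁ := hQ₁.isOpField_semigroup hT₁
  have hm₂ := hQ₂.isOpField_semigroup hT₂
  have hord := isOrderPreserving_dint_iff hμ₁ hd₁ hS₁ hU
  have hall := forall_commutes_dint_iff hU hm₁ hm₂ (fun ζ => (hT₁ ζ).continuous)
    (fun ζ => (hT₂ ζ).continuous)
  refine ⟨hm₁, hm₂, ⟨isUnitary_dint_iff hU, dint_inverse_of_isUnitary hU, hord,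
    fun t => commutes_dint_iff hU (hm₁ t) (hm₂ t),
    fun h t => intertwines_dint_iff hU h (hm₁ t) (hm₂ t), hall⟩, fun hs₁ hs₂ => ?_⟩
  obtain ⟨ι₁, hι₁⟩ := exists_isCanonical hμ₁ hd₁ hS₁ hs₁
  obtain ⟨ι₂, hι₂⟩ := exists_isCanonical hμ₂ hd₂ hS₂ hs₂
  refine ⟨ι₁, ι₂, hι₁, hι₂, ?_, ?_, ?_, ?_, ?_, ?_⟩
  · rw [isUnitary_pull_iff, isUnitary_dint_iff hU]
  · rw [isUnitary_pull_iff]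
    intro h
    obtain ⟨hI, h1, h2⟩ := dint_inverse_of_isUnitary hU h
    exact ⟨hI, by rw [pull_comp, h1, pull_id], by rw [pull_comp, h2, pull_id]⟩
  · rw [isOrderPreserving_pull_iff hd₁ hd₂ hι₁ hι₂, hord]
  · intro t
    rw [commutes_pull_iff, commutes_dint_iff hU (hm₁ t) (hm₂ t)]
  · rw [isInvertible_pull_iff]
    intro h t
    rw [intertwines_pull_iff, intertwines_dint_iff hU h (hm₁ t) (hm₂ t)]
  · simp only [commutes_pull_iff]
    exact hall
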